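/- Let $K$ be a locally compact hypergroup: a locally compact Hausdorff space with regular Borel probability measures $\delta_x*\delta_y$ of compact support ($x,y\in K$) such that $(x,y)\mapsto\delta_x*\delta_y$ is weakly continuous, $(x,y)\mapsto\operatorname{supp}(\delta_x*\delta_y)$ is continuous for the Michael (Vietoris) topology, the convolution is associative, there is an identity $e$ with $\delta_e*\delta_x=\delta_x*\delta_e=\delta_x$, and there is a continuous involution $x\mapsto\check x$ with $(\delta_x*\delta_y)\check{}=\delta_{\check y}*\delta_{\check x}$ and $e\in\operatorname{supp}(\delta_x*\delta_y)\iff x=\check y$. Write $f(x*y)=\int_K f\,d(\delta_x*\delta_y)$, and let $M(K)$ be the space of bounded regular complex Borel measures on $K$, with the convolution $\int f\,d(\mu*\nu)=\int\!\!\int f(x*y)\,d\mu(x)\,d\nu(y)$ for $f\in C_0(K)$. For $A,B\subseteq K$ put $A*B=\bigcup_{x\in A,\,y\in B}\operatorname{supp}(\delta_x*\delta_y)$, and let $A^n$ be the $n$-fold product of $A$ with itself. Suppose that $K$ is non-compact, and let $\sigma$ be a regular Borel probability measure on $K$ that is non-degenerate, i.e. $K=\overline{\bigcup_{n\ge1}(\operatorname{supp}\sigma)^n}$.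 Then: (a) $H_\sigma(K):=\{\mu\in M(K):\sigma*\mu=\mu\}=\{0\}$; (b) for every left Haar measure $\omega$ on $K$ (a non-zero positive Radon measure with $\int f(x*y)\,d\omega(y)=\int f\,d\omega$ for all $x\in K$ and $f\in C_c(K)$), $H^1_\sigma(K):=\{f\in L^1(K,\omega):\sigma*f=f\ \ \omega\text{-a.e.}\}=\{0\}$, where $(\sigma*f)(x)=\int_K f(\check y*x)\,d\sigma(y)$. -/

import Mathlib

open MeasureTheory Topology
open scoped BoundedContinuousFunction ZeroAtInfty CompactlySupported

/-- A (locally compact) hypergroup.  The convolution is recorded on point masses: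
`conv x y` is the regular probability measure `δ_x * δ_y`.  Its extension to bounded regular
complex measures is given by `⟨μ * ν, f⟩ = ∫ ∫ ⟨δ_x * δ_y, f⟩ dμ(x) dν(y)`,
see `Hypergroup.IsConv`; `conv_assoc` is the associativity
`(δ_x * δ_y) * δ_z = δ_x * (δ_y * δ_z)`, tested against bounded continuous functions. -/
class Hypergroup (K : Type*) [TopologicalSpace K] [T2Space K] [LocallyCompactSpace K]
    [MeasurableSpace K] [BorelSpace K] where
  /-- `δ_x * δ_y`. -/
  conv : K → K → ProbabilityMeasure K
  /-- The identity element. -/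
  e : K
  /-- The involution `x ↦ x̌`. -/
  inv : K → K
  conv_regular : ∀ x y, (conv x y : Measure K).Regular
  isCompact_support_conv : ∀ x y, IsCompact (conv x y : Measure K).support
  /-- Continuity of `(x, y) ↦ supp (δ_x * δ_y)` for the Michael (Vietoris) topology, generated by
  the sets `{C | C ⊆ U}` and `{C | C ∩ U ≠ ∅}` with `U` open. -/
  continuous_support_conv :
    @Continuous (K × K) (Set K) inferInstance (TopologicalSpace.vietoris K)
      (fun p => (conv p.1 p.2 : Measure K).support)
  /-- Continuity of `(x, y) ↦ δ_x * δ_y` for the weak topology on probability measures. -/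
  continuous_conv : Continuous (fun p : K × K => conv p.1 p.2)
  conv_assoc : ∀ (x y z : K) (f : K →ᵇ ℂ),
    ∫ t, (∫ s, f s ∂(conv t z : Measure K)) ∂(conv x y : Measure K) =
      ∫ t, (∫ s, f s ∂(conv x t : Measure K)) ∂(conv y z : Measure K)
  e_conv : ∀ x, (conv e x : Measure K) = Measure.dirac x
  conv_e : ∀ x, (conv x e : Measure K) = Measure.dirac x
  continuous_inv : Continuous inv
  inv_inv : ∀ x, inv (inv x) = x
  map_inv_conv : ∀ x y, (conv x y : Measure K).map inv = (conv (inv y) (inv x) : Measure K)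
  e_mem_support_conv : ∀ x y, e ∈ (conv x y : Measure K).support ↔ x = inv y

namespace Hypergroup

noncomputable section

variable {K : Type*} [TopologicalSpace K] [T2Space K] [LocallyCompactSpace K]
  [MeasurableSpace K] [BorelSpace K] [Hypergroup K]

/-- `f(x * y) = ∫ f d(δ_x * δ_y)`. -/
def translate (f : K → ℂ) (x y : K) : ℂ := ∫ t, f t ∂(conv x y : Measure K)

/-- The product of sets `A * B = ⋃_{x ∈ A, y ∈ B} supp (δ_x * δ_y)`. -/
def setMul (A B : Set K) : Set K := ⋃ x ∈ A, ⋃ y ∈ B, (conv x y : Measure K).support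

/-- `setPowSucc A n` is the power `A ^ (n + 1)` for `setMul`, so that `setPowSucc A 0 = A`. -/
def setPowSucc (A : Set K) : ℕ → Set K
  | 0 => A
  | n + 1 => setMul (setPowSucc A n) A

/-- A positive measure `σ` is non-degenerate if `⋃_{n ≥ 1} (supp σ)^n` is dense in `K`. -/
def IsNondegenerate (σ : Measure K) : Prop :=
  closure (⋃ n : ℕ, setPowSucc σ.support n) = Set.univ

/-- `μ` belongs to `M(K)`, i.e. the complex Borel measure `μ` is regular: its total variation
measure `|μ|` is.  (Boundedness is automatic for complex measures.) -/
def IsRegularMeasure (μ : ComplexMeasure K) : Prop := μ.variation.Regular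

/-- The integral `∫ f dμ` of a complex function against a complex measure. -/
def cintegral (μ : ComplexMeasure K) (f : K → ℂ) : ℂ :=
  μ.integral f (ContinuousLinearMap.mul ℝ ℂ)

/-- `τ = σ * μ` in `M(K)` for a (finite positive) measure `σ` and a complex measure `μ`:
`∫ f dτ = ∫ (∫ f(x * y) dσ(x)) dμ(y)` for all `f ∈ C₀(K)`. -/
def IsConv (σ : Measure K) (μ τ : ComplexMeasure K) : Prop :=
  IsRegularMeasure τ ∧
    ∀ f : C₀(K, ℂ), cintegral τ f = cintegral μ (fun y => ∫ x, translate f x y ∂σ)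

/-- `H_σ(K)`: the bounded regular complex measures `μ` with `σ * μ = μ`. -/
def harmonicMeasures (σ : Measure K) : Set (ComplexMeasure K) :=
  {μ | IsRegularMeasure μ ∧ IsConv σ μ μ}

/-- `(σ * f)(x) = ∫ f(y̌ * x) dσ(y)`. -/
def convFun (σ : Measure K) (f : K → ℂ) (x : K) : ℂ := ∫ y, translate f (inv y) x ∂σ

/-- A left-invariant Haar measure: a non-zero Radon measure `ω` with `δ_x * ω = ω`, i.e.
`∫ f(x * y) dω(y) = ∫ f dω` for all `f ∈ C_c(K)`, for every `x`. -/
structure IsLeftHaar (ω : Measure K) : Prop where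
  regular : ω.Regular
  ne_zero : ω ≠ 0
  left_invariant : ∀ (x : K) (f : C_c(K, ℂ)), ∫ y, translate f x y ∂ω = ∫ y, f y ∂ω

/-- `H^1_σ(K)`: the `f ∈ L^1(K) = L^1(K, ω)` with `σ * f = f` (as elements of `L^1`, that is,
`ω`-almost everywhere). -/
def harmonicL1 (ω σ : Measure K) : Set (Lp ℂ 1 ω) :=
  {f | convFun σ f =ᵐ[ω] f}

end

end Hypergroup

/-!
Pairing a `σ`-harmonic measure or `L¹` function with the translates of a function in `C_c(K)` gives
a function `F ∈ C₀(K)` with `F z = ∫ F(z * x) dσ(x)`. If `|F|` attains its maximum at `z₀`, strict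
convexity of the disc makes the level set `{F = F z₀}` stable under right multiplication by
`supp σ`, hence, `σ` being non-degenerate, by all of `K`; it contains `e ∈ supp(δ_{z₀} * δ_{ž₀})`
and is therefore `K`. So `F` is constant, and it vanishes since `K` is not compact.

A Haar measure need not be σ-finite, and the space need not be second countable, so Tonelli's
theorem is not available in its usual form. It does hold for lower semicontinuous integrands, as
these are suprema of directed families in `C_c`; on indicators of open sets it shows that the
averaging operators `f ↦ f(z * ·)` and `f ↦ σ * f` are contractions of `L¹(ω)`, which extends
identities from `C_c(K)` to `L¹(ω)`.
-/

section PolarDecomposition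

variable {X : Type*} [MeasurableSpace X]

theorem variation_complexMeasure_le_add (μ : ComplexMeasure X) :
    μ.variation ≤ (ComplexMeasure.re μ).variation + (ComplexMeasure.im μ).variation :=
  VectorMeasure.variation_le_of_forall_enorm_le fun s _ =>
    calc ‖μ s‖ₑ ≤ ‖(μ s).re‖ₑ + ‖(μ s).im‖ₑ := by
          simp only [← ofReal_norm]
          rw [← ENNReal.ofReal_add (norm_nonneg _) (norm_nonneg _)]
          exact ENNReal.ofReal_le_ofReal (Complex.norm_le_abs_re_add_abs_im (μ s))
      _ ≤ _ := add_le_add (VectorMeasure.enorm_measure_le_variation (ComplexMeasure.re μ) s)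
          (VectorMeasure.enorm_measure_le_variation (ComplexMeasure.im μ) s)

instance isFiniteMeasure_variation_complexMeasure (μ : ComplexMeasure X) :
    IsFiniteMeasure μ.variation := by
  have hfin (s : SignedMeasure X) : IsFiniteMeasure s.variation := by
    rw [← SignedMeasure.totalVariation_eq_variation, SignedMeasure.totalVariation]
    infer_instance
  exact isFiniteMeasure_of_le _ (variation_complexMeasure_le_add μ)

theorem withDensityᵥ_rnDeriv_variation (μ : ComplexMeasure X) :
    μ.variation.withDensityᵥ (μ.rnDeriv μ.variation) = μ := by
  have hac : μ ≪ᵥ μ.variation.toENNRealVectorMeasure := fun s hs => by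
    by_cases hsm : MeasurableSet s
    · rw [Measure.toENNRealVectorMeasure_apply_measurable hsm] at hs
      exact enorm_eq_zero.1 (le_zero_iff.1 (hs ▸ VectorMeasure.enorm_measure_le_variation μ s))
    · exact VectorMeasure.not_measurable μ hsm
  obtain ⟨hre, him⟩ := (ComplexMeasure.absolutelyContinuous_ennreal_iff μ _).1 hac
  have hint := ComplexMeasure.integrable_rnDeriv μ μ.variation
  ext s hs
  rw [withDensityᵥ_apply hint hs]
  refine Complex.ext ?_ ?_
  · rw [← RCLike.re_eq_complex_re, ← integral_re hint.integrableOn]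
    exact (withDensityᵥ_apply hint.re hs).symm.trans
      (congrArg (· s) (SignedMeasure.withDensityᵥ_rnDeriv_eq _ _ hre))
  · rw [← RCLike.im_eq_complex_im, ← integral_im hint.integrableOn]
    exact (withDensityᵥ_apply hint.im hs).symm.trans
      (congrArg (· s) (SignedMeasure.withDensityᵥ_rnDeriv_eq _ _ him))

theorem enorm_rnDeriv_variation_ae_eq_one (μ : ComplexMeasure X) :
    ∀ᵐ x ∂μ.variation, ‖μ.rnDeriv μ.variation x‖ₑ = 1 := by
  have hint := ComplexMeasure.integrable_rnDeriv μ μ.variation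
  refine (withDensity_eq_iff hint.1.enorm aemeasurable_const hint.2.ne).1 ?_
  rw [← Measure.variation_withDensityᵥ hint, withDensityᵥ_rnDeriv_variation, withDensity_const,
    one_smul]

theorem norm_rnDeriv_variation_ae_eq_one (μ : ComplexMeasure X) :
    ∀ᵐ x ∂μ.variation, ‖μ.rnDeriv μ.variation x‖ = 1 :=
  (enorm_rnDeriv_variation_ae_eq_one μ).mono fun x hx => by
    rw [← toReal_enorm, hx, ENNReal.toReal_one]

theorem integrable_mul_rnDeriv_variation {μ : ComplexMeasure X} {f : X → ℂ}
    (hf : Integrable f μ.variation) :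
    Integrable (fun x => f x * μ.rnDeriv μ.variation x) μ.variation :=
  hf.mul_bdd (c := 1) (ComplexMeasure.integrable_rnDeriv μ μ.variation).1
    ((norm_rnDeriv_variation_ae_eq_one μ).mono fun _ hx => hx.le)

theorem continuous_integral_mul_rnDeriv_variation (μ : ComplexMeasure X) :
    Continuous fun f : Lp ℂ 1 μ.variation => ∫ x, f x * μ.rnDeriv μ.variation x ∂μ.variation := by
  set θ := μ.rnDeriv μ.variation
  have hint (f : Lp ℂ 1 μ.variation) : Integrable (fun x => f x * θ x) μ.variation :=
    integrable_mul_rnDeriv_variation (L1.integrable_coeFn f)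
  refine LipschitzWith.continuous (K := 1) (.of_dist_le_mul fun f g => ?_)
  calc dist (∫ x, f x * θ x ∂μ.variation) (∫ x, g x * θ x ∂μ.variation)
      = ‖∫ x, (f x * θ x - g x * θ x) ∂μ.variation‖ := by
        rw [dist_eq_norm, integral_sub (hint f) (hint g)]
    _ ≤ ∫ x, ‖f x * θ x - g x * θ x‖ ∂μ.variation := norm_integral_le_integral_norm _
    _ = ∫ x, ‖(f - g : Lp ℂ 1 μ.variation) x‖ ∂μ.variation := integral_congr_ae (by
        filter_upwards [norm_rnDeriv_variation_ae_eq_one μ, Lp.coeFn_sub f g] with x hθ hfg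
        rw [← sub_mul, norm_mul, hθ, mul_one, hfg, Pi.sub_apply])
    _ = (1 : NNReal) * dist f g := by
        rw [NNReal.coe_one, one_mul, dist_eq_norm, L1.norm_eq_integral_norm]

theorem Hypergroup.cintegral_eq_integral_mul_rnDeriv (μ : ComplexMeasure X) {f : X → ℂ}
    (hf : Integrable f μ.variation) :
    cintegral μ f = ∫ x, f x * μ.rnDeriv μ.variation x ∂μ.variation := by
  set θ := μ.rnDeriv μ.variation
  refine Integrable.induction (fun g => cintegral μ g = ∫ x, g x * θ x ∂μ.variation)
    (fun c s hs _ => ?_) (fun g h _ hg hh hPg hPh => ?_) ?_ (fun g h hgh _ hPg => ?_) hf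
  · calc cintegral μ (s.indicator fun _ => c) = c * μ s :=
          VectorMeasure.integral_indicator_const c hs
      _ = c * ∫ x in s, θ x ∂μ.variation := by
          rw [← withDensityᵥ_apply (ComplexMeasure.integrable_rnDeriv μ μ.variation) hs,
            withDensityᵥ_rnDeriv_variation]
      _ = ∫ x, s.indicator (fun _ => c) x * θ x ∂μ.variation := by
          simp only [← Set.indicator_mul_left, integral_indicator hs, integral_const_mul]
  · calc cintegral μ (g + h) = cintegral μ g + cintegral μ h := VectorMeasure.integral_add hg hh
      _ = ∫ x, (g + h) x * θ x ∂μ.variation := by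
          simp only [hPg, hPh, Pi.add_apply, add_mul, θ, integral_add
            (integrable_mul_rnDeriv_variation hg) (integrable_mul_rnDeriv_variation hh)]
  · exact isClosed_eq VectorMeasure.continuous_integral
      (continuous_integral_mul_rnDeriv_variation μ)
  · calc cintegral μ h = cintegral μ g := (VectorMeasure.integral_congr_ae hgh).symm
      _ = ∫ x, h x * θ x ∂μ.variation :=
          hPg.trans (integral_congr_ae (hgh.mono fun x hx => congrArg (· * θ x) hx))

end PolarDecomposition

section Semicontinuous

open Filter Set
open scoped ENNReal NNReal

theorem tsum_ite_mul_lt_le (δ a : ℝ≥0∞) : ∑' k : ℕ, (if (k + 1) * δ < a then δ else 0) ≤ a := by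
  refine ENNReal.tsum_le_of_sum_range_le fun n => ?_
  suffices h : ∑ k ∈ Finset.range n, (if (k + 1) * δ < a then δ else 0) ≤ min a (n * δ) from
    h.trans (min_le_left _ _)
  induction n with
  | zero => simp
  | succ n ih =>
    rw [Finset.sum_range_succ]
    split_ifs with hn
    · rw [Nat.cast_succ, min_eq_right hn.le, add_one_mul]
      exact add_le_add_left (ih.trans (min_le_right _ _)) δ
    · rw [add_zero]
      exact ih.trans (min_le_min_left a (by gcongr; exact n.le_succ))

theorem le_tsum_ite_mul_lt_add {δ : ℝ≥0∞} (hδ : δ ≠ 0) (a : ℝ≥0∞) :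
    a ≤ ∑' k : ℕ, (if (k + 1) * δ < a then δ else 0) + δ := by
  have hpartial (n : ℕ) :
      min a ((n + 1) * δ) ≤ ∑ k ∈ Finset.range n, (if (k + 1) * δ < a then δ else 0) + δ := by
    induction n with
    | zero => simp
    | succ n ih =>
      rw [Finset.sum_range_succ]
      split_ifs with hn
      · rw [min_eq_right hn.le] at ih
        calc min a (((n + 1 : ℕ) + 1) * δ) ≤ (n + 1) * δ + δ :=
              (min_le_right _ _).trans_eq (by rw [add_one_mul, Nat.cast_succ])
          _ ≤ _ := by gcongr
      · rw [add_zero]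
        refine (min_le_left _ _).trans ?_
        rwa [min_eq_left (not_lt.1 hn)] at ih
  have hlim : Tendsto (fun n : ℕ => ((n : ℝ≥0∞) + 1) * δ) atTop (𝓝 ⊤) := by
    have h := ENNReal.Tendsto.mul_const (b := δ)
      (ENNReal.tendsto_nat_nhds_top.comp (tendsto_add_atTop_nat 1)) (.inl ENNReal.top_ne_zero)
    simpa only [ENNReal.top_mul hδ, Function.comp_apply, Nat.cast_add_one] using h
  refine le_of_tendsto' (by simpa using tendsto_const_nhds.min hlim) fun n =>
    (hpartial n).trans ?_
  gcongr
  exact ENNReal.sum_le_tsum _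

theorem le_liminf_tsum_ite_mul_lt (a : ℝ≥0∞) :
    a ≤ liminf (fun N : ℕ => ∑' k : ℕ, (if (k + 1) * (N : ℝ≥0∞)⁻¹ < a then (N : ℝ≥0∞)⁻¹ else 0))
      atTop := by
  have hlim : Tendsto (fun N : ℕ => a - (N : ℝ≥0∞)⁻¹) atTop (𝓝 a) := by
    simpa using ENNReal.Tendsto.sub tendsto_const_nhds ENNReal.tendsto_inv_nat_nhds_zero
      (.inr ENNReal.zero_ne_top)
  refine hlim.liminf_eq.symm.le.trans (liminf_le_liminf (.of_forall fun N => ?_))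
  exact tsub_le_iff_right.2 (le_tsum_ite_mul_lt_add (by simp) a)

variable {X ι : Type*} [TopologicalSpace X] [MeasurableSpace X] (μ : Measure X)

theorem measure_iUnion_eq_iSup_of_isOpen [μ.Regular] {U : ι → Set X} (hU : ∀ i, IsOpen (U i))
    (hd : Directed (· ⊆ ·) U) : μ (⋃ i, U i) = ⨆ i, μ (U i) := by
  refine le_antisymm ?_ (iSup_le fun i => measure_mono (subset_iUnion U i))
  cases isEmpty_or_nonempty ι
  · simp
  refine le_of_forall_lt fun r hr => ?_
  obtain ⟨C, hCU, hC, hrC⟩ := (isOpen_iUnion hU).exists_lt_isCompact hr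
  obtain ⟨i, hi⟩ := hC.elim_directed_cover U hU hCU hd
  exact hrC.trans_le ((measure_mono hi).trans (le_iSup (fun i => μ (U i)) i))

variable [OpensMeasurableSpace X]

theorem lintegral_tsum_ite_mul_lt {f : X → ℝ≥0∞} (hf : LowerSemicontinuous f) (δ : ℝ≥0∞) :
    ∫⁻ x, ∑' k : ℕ, (if (k + 1) * δ < f x then δ else 0) ∂μ =
      ∑' k : ℕ, δ * μ {x | (k + 1) * δ < f x} := by
  have hmeas (k : ℕ) : MeasurableSet {x | (k + 1) * δ < f x} :=
    (hf.isOpen_preimage _).measurableSet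
  rw [lintegral_tsum fun k => (measurable_const.ite (hmeas k) measurable_const).aemeasurable]
  simp only [← lintegral_indicator_const (hmeas _), indicator_apply, mem_ofPred_eq]

theorem tsum_mul_measure_lt_iSup_le [μ.Regular] {f : ι → X → ℝ≥0∞}
    (hf : ∀ i, LowerSemicontinuous (f i)) (hd : Directed (· ≤ ·) f) (δ : ℝ≥0∞) :
    ∑' k : ℕ, δ * μ {x | (k + 1) * δ < ⨆ i, f i x} ≤ ⨆ i, ∫⁻ x, f i x ∂μ := by
  have hlevel (c : ℝ≥0∞) : δ * μ {x | c < ⨆ i, f i x} = ⨆ i, δ * μ {x | c < f i x} := by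
    simp only [lt_iSup_iff, ofPred_exists]
    rw [measure_iUnion_eq_iSup_of_isOpen μ (U := fun i => {x | c < f i x})
      (fun i => (hf i).isOpen_preimage c) fun i j => (hd i j).imp fun k hk =>
        ⟨fun x hx => lt_of_lt_of_le hx (hk.1 x), fun x hx => lt_of_lt_of_le hx (hk.2 x)⟩,
      ENNReal.mul_iSup]
  simp only [hlevel]
  refine ENNReal.tsum_le_of_sum_range_le fun n => ?_
  have hdirected (i j : ι) : ∃ k, ∀ m : ℕ,
      δ * μ {x | (m + 1) * δ < f i x} ≤ δ * μ {x | (m + 1) * δ < f k x} ∧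
        δ * μ {x | (m + 1) * δ < f j x} ≤ δ * μ {x | (m + 1) * δ < f k x} :=
    (hd i j).imp fun k hk m =>
      ⟨mul_right_mono (measure_mono fun x hx => lt_of_lt_of_le hx (hk.1 x)),
        mul_right_mono (measure_mono fun x hx => lt_of_lt_of_le hx (hk.2 x))⟩
  rw [ENNReal.finsetSum_iSup hdirected]
  refine iSup_mono fun i => ?_
  calc ∑ k ∈ Finset.range n, δ * μ {x | (k + 1) * δ < f i x}
      ≤ ∑' k : ℕ, δ * μ {x | (k + 1) * δ < f i x} := ENNReal.sum_le_tsum _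
    _ = ∫⁻ x, ∑' k : ℕ, (if (k + 1) * δ < f i x then δ else 0) ∂μ :=
        (lintegral_tsum_ite_mul_lt μ (hf i) δ).symm
    _ ≤ ∫⁻ x, f i x ∂μ := lintegral_mono fun x => tsum_ite_mul_lt_le δ (f i x)

/- The directed family may be uncountable, so monotone convergence does not apply.  Approximating
`f` by `∑ k, δ * 1_{(k + 1) δ < f}` reduces the claim to superlevel sets, which are open. -/
theorem lintegral_iSup_of_lowerSemicontinuous [μ.Regular] {f : ι → X → ℝ≥0∞}
    (hf : ∀ i, LowerSemicontinuous (f i)) (hd : Directed (· ≤ ·) f) :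
    ∫⁻ x, ⨆ i, f i x ∂μ = ⨆ i, ∫⁻ x, f i x ∂μ := by
  refine le_antisymm ?_ (iSup_lintegral_le _)
  have hF : LowerSemicontinuous fun x => ⨆ i, f i x := lowerSemicontinuous_iSup hf
  have hmeas : Measurable fun x => ⨆ i, f i x := hF.measurable
  calc ∫⁻ x, ⨆ i, f i x ∂μ
      ≤ ∫⁻ x, liminf (fun N : ℕ => ∑' k : ℕ,
          (if (k + 1) * (N : ℝ≥0∞)⁻¹ < ⨆ i, f i x then (N : ℝ≥0∞)⁻¹ else 0)) atTop ∂μ :=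
        lintegral_mono fun x => le_liminf_tsum_ite_mul_lt _
    _ ≤ liminf (fun N : ℕ => ∫⁻ x, ∑' k : ℕ,
          (if (k + 1) * (N : ℝ≥0∞)⁻¹ < ⨆ i, f i x then (N : ℝ≥0∞)⁻¹ else 0) ∂μ) atTop :=
        lintegral_liminf_le fun N => Measurable.tsum fun k =>
          Measurable.ite (measurableSet_lt measurable_const hmeas) measurable_const
            measurable_const
    _ ≤ ⨆ i, ∫⁻ x, f i x ∂μ := liminf_le_of_frequently_le' (.of_forall fun N =>
        (lintegral_tsum_ite_mul_lt μ hF _).trans_le (tsum_mul_measure_lt_iSup_le μ hf hd _))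

end Semicontinuous

section CompactlySupported

open Filter Set
open scoped ENNReal NNReal

variable {X Y : Type*} [TopologicalSpace X] [TopologicalSpace Y]

theorem exists_compactlySupported_eqOn_one [RegularSpace X] [LocallyCompactSpace X]
    {C U : Set X} (hC : IsCompact C) (hU : IsOpen U) (hCU : C ⊆ U) :
    ∃ φ : C_c(X, ℝ≥0), EqOn φ 1 C ∧ EqOn φ 0 Uᶜ ∧ ∀ x, φ x ≤ 1 := by
  obtain ⟨φ, hone, hzero, hcompact, hφ⟩ := exists_continuous_one_zero_of_isCompact hC
    hU.isClosed_compl (disjoint_compl_right_iff_subset.2 hCU)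
  exact ⟨⟨ContinuousMap.realToNNReal.comp φ, hcompact.comp_left Real.toNNReal_zero⟩,
    fun x hx => (congrArg Real.toNNReal (hone hx)).trans Real.toNNReal_one,
    fun x hx => (congrArg Real.toNNReal (hzero hx)).trans Real.toNNReal_zero,
    fun x => Real.toNNReal_le_one.2 (hφ x).2⟩

/-- The continuous compactly supported functions below `F`; on a locally compact regular space
`F` is their supremum if it is lower semicontinuous. -/
abbrev compactMinorants (F : X → ℝ≥0∞) : Set C_c(X, ℝ≥0) := {h | ∀ x, (h x : ℝ≥0∞) ≤ F x}

theorem directed_compactMinorants (F : X → ℝ≥0∞) :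
    Directed (· ≤ ·) fun (h : compactMinorants F) x => (h.1 x : ℝ≥0∞) := fun g h =>
  ⟨⟨g.1 ⊔ h.1, fun x => by
      rw [CompactlySupportedContinuousMap.sup_apply, ENNReal.coe_max]
      exact max_le (g.2 x) (h.2 x)⟩,
    fun x => ENNReal.coe_le_coe.2 le_sup_left, fun x => ENNReal.coe_le_coe.2 le_sup_right⟩

theorem iSup_compactMinorants_eq [RegularSpace X] [LocallyCompactSpace X]
    {F : X → ℝ≥0∞} (hF : LowerSemicontinuous F) (x : X) :
    ⨆ h : compactMinorants F, (h.1 x : ℝ≥0∞) = F x := by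
  refine le_antisymm (iSup_le fun h => h.2 x) (ENNReal.le_of_forall_nnreal_lt fun c hc => ?_)
  obtain ⟨φ, hone, hzero, hφ⟩ := exists_compactlySupported_eqOn_one (isCompact_singleton (x := x))
    (hF.isOpen_preimage c) (singleton_subset_iff.2 hc)
  refine le_iSup_of_le ⟨c • φ, fun y => ?_⟩ ?_
  · by_cases hy : (c : ℝ≥0∞) < F y
    · exact (ENNReal.coe_le_coe.2 (mul_le_of_le_one_right' (hφ y))).trans hy.le
    · simp [hzero hy]
  · simp [hone (mem_singleton x)]

theorem lintegral_comp_eq_iSup_compactMinorants [RegularSpace X] [LocallyCompactSpace X]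
    [MeasurableSpace Y] [OpensMeasurableSpace Y] (n : Measure Y) [n.Regular] {F : X → ℝ≥0∞}
    (hF : LowerSemicontinuous F) {g : Y → X} (hg : Continuous g) :
    ∫⁻ y, F (g y) ∂n = ⨆ h : compactMinorants F, ∫⁻ y, h.1 (g y) ∂n := by
  simp only [← iSup_compactMinorants_eq hF]
  exact lintegral_iSup_of_lowerSemicontinuous n
    (fun h => (ENNReal.continuous_coe.comp (h.1.continuous.comp hg)).lowerSemicontinuous)
    fun h k => (directed_compactMinorants F h k).imp
      fun l hl => ⟨fun y => hl.1 (g y), fun y => hl.2 (g y)⟩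

theorem lintegral_eq_iSup_compactMinorants [RegularSpace X] [LocallyCompactSpace X]
    [MeasurableSpace X] [OpensMeasurableSpace X] (μ : Measure X) [μ.Regular] {F : X → ℝ≥0∞}
    (hF : LowerSemicontinuous F) :
    ∫⁻ x, F x ∂μ = ⨆ h : compactMinorants F, ∫⁻ x, h.1 x ∂μ :=
  lintegral_comp_eq_iSup_compactMinorants μ hF continuous_id

variable [MeasurableSpace Y] [OpensMeasurableSpace Y]

theorem continuous_lintegral_compactlySupported [T2Space Y] (n : Measure Y)
    [IsFiniteMeasureOnCompacts n] (h : C_c(X × Y, ℝ≥0)) :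
    Continuous fun x => ∫⁻ y, h (x, y) ∂n := by
  have hcompact : IsCompact (Prod.snd '' tsupport h) := h.hasCompactSupport.image continuous_snd
  have hzero (x : X) (y : Y) (hy : y ∉ Prod.snd '' tsupport h) : (h (x, y) : ℝ) = 0 :=
    NNReal.coe_eq_zero.2 (image_eq_zero_of_notMem_tsupport fun hxy => hy ⟨(x, y), hxy, rfl⟩)
  have hcont : Continuous fun p : X × Y => (h p : ℝ) := NNReal.continuous_coe.comp h.continuous
  have hintegral (x : X) : ∫⁻ y, h (x, y) ∂n = ENNReal.ofReal (∫ y, (h (x, y) : ℝ) ∂n) :=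
    lintegral_coe_eq_integral _ (Continuous.integrable_of_hasCompactSupport
      (hcont.comp (Continuous.prodMk_right x)) (HasCompactSupport.intro hcompact (hzero x)))
  simp only [hintegral]
  refine ENNReal.continuous_ofReal.comp (continuousOn_univ.1 ?_)
  exact continuousOn_integral_of_compact_support hcompact hcont.continuousOn
    fun x y _ hy => hzero x y hy

theorem lowerSemicontinuous_lintegral_prodMk [RegularSpace X] [T2Space Y] [LocallyCompactSpace X]
    [LocallyCompactSpace Y] (n : Measure Y) [n.Regular] {F : X × Y → ℝ≥0∞}
    (hF : LowerSemicontinuous F) : LowerSemicontinuous fun x => ∫⁻ y, F (x, y) ∂n := by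
  simp only [fun x : X => lintegral_comp_eq_iSup_compactMinorants n hF (Continuous.prodMk_right x)]
  exact lowerSemicontinuous_iSup fun h =>
    (continuous_lintegral_compactlySupported n h.1).lowerSemicontinuous

variable [MeasurableSpace X] [OpensMeasurableSpace X]

theorem lintegral_lintegral_swap_compactlySupported (m : Measure X) (n : Measure Y)
    [IsFiniteMeasureOnCompacts m] [IsFiniteMeasureOnCompacts n] (h : C_c(X × Y, ℝ≥0)) :
    ∫⁻ x, ∫⁻ y, h (x, y) ∂n ∂m = ∫⁻ y, ∫⁻ x, h (x, y) ∂m ∂n := by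
  set C : Set X := Prod.fst '' tsupport h
  set D : Set Y := Prod.snd '' tsupport h
  have hC : IsCompact C := h.hasCompactSupport.image continuous_fst
  have hD : IsCompact D := h.hasCompactSupport.image continuous_snd
  have hsupport {x : X} {y : Y} (hne : h (x, y) ≠ 0) : x ∈ C ∧ y ∈ D :=
    have hxy := subset_tsupport h hne
    ⟨⟨(x, y), hxy, rfl⟩, ⟨(x, y), hxy, rfl⟩⟩
  have hx (y : Y) : ∫⁻ x in C, h (x, y) ∂m = ∫⁻ x, h (x, y) ∂m :=
    setLIntegral_eq_of_support_subset fun x hne => (hsupport (ENNReal.coe_ne_zero.1 hne)).1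
  have hy (x : X) : ∫⁻ y in D, h (x, y) ∂n = ∫⁻ y, h (x, y) ∂n :=
    setLIntegral_eq_of_support_subset fun y hne => (hsupport (ENNReal.coe_ne_zero.1 hne)).2
  have hC' : (Function.support fun x => ∫⁻ y, h (x, y) ∂n) ⊆ C := fun x hne => by
    by_contra hxC
    have hzero (y : Y) : h (x, y) = 0 := of_not_not fun h => hxC (hsupport h).1
    simp [hzero] at hne
  have hD' : (Function.support fun y => ∫⁻ x, h (x, y) ∂m) ⊆ D := fun y hne => by
    by_contra hyD
    have hzero (x : X) : h (x, y) = 0 := of_not_not fun h => hyD (hsupport h).2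
    simp [hzero] at hne
  have : IsFiniteMeasure (m.restrict C) := ⟨by simpa using hC.measure_lt_top⟩
  have : IsFiniteMeasure (n.restrict D) := ⟨by simpa using hD.measure_lt_top⟩
  have hmeas : Measurable fun p : X × Y => (h p : ℝ≥0∞) :=
    (h.hasCompactSupport.measurable_of_prod h.continuous).coe_nnreal_ennreal
  rw [← setLIntegral_eq_of_support_subset hC', ← setLIntegral_eq_of_support_subset hD']
  simp only [← hx, ← hy]
  exact lintegral_lintegral_swap hmeas.aemeasurable

theorem lintegral_lintegral_swap_of_lowerSemicontinuous [T2Space X] [T2Space Y]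
    [LocallyCompactSpace X] [LocallyCompactSpace Y]
    (m : Measure X) (n : Measure Y) [m.Regular] [n.Regular] {F : X × Y → ℝ≥0∞}
    (hF : LowerSemicontinuous F) :
    ∫⁻ x, ∫⁻ y, F (x, y) ∂n ∂m = ∫⁻ y, ∫⁻ x, F (x, y) ∂m ∂n := by
  have hd := directed_compactMinorants F
  have hswap (h : C_c(X × Y, ℝ≥0)) :
      Continuous fun y => ∫⁻ x, (h (x, y) : ℝ≥0∞) ∂m :=
    continuous_lintegral_compactlySupported m (h.comp (Homeomorph.prodComm Y X).toCocompactMap)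
  simp only [fun x : X => lintegral_comp_eq_iSup_compactMinorants n hF (Continuous.prodMk_right x),
    fun y : Y => lintegral_comp_eq_iSup_compactMinorants m hF (Continuous.prodMk_left y)]
  rw [lintegral_iSup_of_lowerSemicontinuous m
      (fun h => (continuous_lintegral_compactlySupported n h.1).lowerSemicontinuous)
      fun g h => (hd g h).imp fun k hk => ⟨fun x => lintegral_mono fun y => hk.1 (x, y),
        fun x => lintegral_mono fun y => hk.2 (x, y)⟩,
    lintegral_iSup_of_lowerSemicontinuous n (fun h => (hswap h.1).lowerSemicontinuous)
      fun g h => (hd g h).imp fun k hk => ⟨fun y => lintegral_mono fun x => hk.1 (x, y),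
        fun y => lintegral_mono fun x => hk.2 (x, y)⟩]
  simp only [lintegral_lintegral_swap_compactlySupported]

end CompactlySupported

section Approximation

open Set
open scoped ENNReal NNReal

variable {X Y E : Type*} [TopologicalSpace X] [TopologicalSpace Y] [NormedAddCommGroup E]

theorem exists_zeroAtInfty_eq_of_forall_norm_sub_le {F : X → E}
    (h : ∀ ε > 0, ∃ g : C_c(X, E), ∀ x, ‖F x - g x‖ ≤ ε) : ∃ F₀ : C₀(X, E), ⇑F₀ = F := by
  refine ⟨⟨⟨F, continuous_of_uniform_approx_of_continuous fun u hu => ?_⟩, ?_⟩, rfl⟩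
  · obtain ⟨ε, hε, hu⟩ := Metric.mem_uniformity_dist.1 hu
    obtain ⟨g, hg⟩ := h (ε / 2) (half_pos hε)
    exact ⟨g, g.continuous, fun x => hu <| by
      simpa only [dist_eq_norm] using (hg x).trans_lt (half_lt_self hε)⟩
  · refine Metric.tendsto_nhds.2 fun ε hε => ?_
    obtain ⟨g, hg⟩ := h (ε / 2) (half_pos hε)
    filter_upwards [g.hasCompactSupport.compl_mem_cocompact] with x hx
    simpa [image_eq_zero_of_notMem_tsupport hx] using (hg x).trans_lt (half_lt_self hε)

variable [T2Space X] [MeasurableSpace X] [BorelSpace X]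

theorem exists_seq_isCompact_ae_mem_iUnion (m : Measure X) [IsFiniteMeasure m]
    [m.Regular] : ∃ C : ℕ → Set X, (∀ k, IsCompact (C k)) ∧ ∀ᵐ x ∂m, x ∈ ⋃ k, C k := by
  choose C _ hC hlt using fun k : ℕ => MeasurableSet.univ.exists_isCompact_sdiff_lt
    (measure_ne_top m univ) (ε := (k + 1 : ℝ≥0∞)⁻¹) (by simp)
  refine ⟨C, hC, le_antisymm (ENNReal.le_of_forall_pos_le_add fun ε hε _ => ?_) zero_le⟩
  obtain ⟨k, hk⟩ := ENNReal.exists_inv_nat_lt (ENNReal.coe_pos.2 hε).ne'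
  rw [zero_add]
  calc m (⋃ k, C k)ᶜ ≤ m (univ \ C k) := measure_mono
          fun x hx => ⟨trivial, fun h => hx (mem_iUnion_of_mem k h)⟩
    _ ≤ (ε : ℝ≥0∞) := ((hlt k).le.trans (ENNReal.inv_le_inv.2 le_self_add)).trans hk.le

variable [LocallyCompactSpace X] [NormedSpace ℝ E]

theorem exists_compactlySupported_enorm_indicator_sub_le (ω : Measure X) [ω.Regular] {s : Set X}
    (hs : MeasurableSet s) (hfin : ω s ≠ ∞) {δ : ℝ≥0∞} (hδ : δ ≠ 0) :
    ∃ φ : C_c(X, ℝ≥0), ∃ D, MeasurableSet D ∧ ω D < δ ∧ ∀ x (v : E),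
      ‖s.indicator (fun _ => v) x - (φ x : ℝ) • v‖ₑ ≤ D.indicator (fun _ => ‖v‖ₑ) x := by
  have hδ2 : δ / 2 ≠ 0 := (ENNReal.half_pos hδ).ne'
  obtain ⟨C, hCs, hC, hltC⟩ := hs.exists_isCompact_sdiff_lt hfin hδ2
  obtain ⟨U, hsU, hU, -, hltU⟩ := hs.exists_isOpen_sdiff_lt hfin hδ2
  obtain ⟨φ, hone, hzero, hφ⟩ := exists_compactlySupported_eqOn_one hC hU (hCs.trans hsU)
  refine ⟨φ, s \ C ∪ U \ s, (hs.diff hC.measurableSet).union (hU.measurableSet.diff hs),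
    (measure_union_le _ _).trans_lt <|
      (ENNReal.add_lt_add hltC hltU).trans_eq (ENNReal.add_halves δ), fun x v => ?_⟩
  by_cases hxs : x ∈ s
  · by_cases hxC : x ∈ C
    · simp [hxs, hone hxC]
    · have hnorm : ‖(1 - φ x : ℝ)‖ ≤ 1 := by
        rw [Real.norm_eq_abs, abs_of_nonneg (sub_nonneg.2 (NNReal.coe_le_one.2 (hφ x)))]
        exact sub_le_self _ (φ x).2
      rw [indicator_of_mem hxs, indicator_of_mem (.inl ⟨hxs, hxC⟩), enorm_le_iff_norm_le]
      calc ‖v - (φ x : ℝ) • v‖ = ‖(1 - φ x : ℝ)‖ * ‖v‖ := by rw [← norm_smul, sub_smul, one_smul]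
        _ ≤ ‖v‖ := mul_le_of_le_one_left (norm_nonneg v) hnorm
  · by_cases hxU : x ∈ U
    · rw [indicator_of_notMem hxs, indicator_of_mem (.inr ⟨hxU, hxs⟩), enorm_le_iff_norm_le,
        zero_sub, norm_neg, norm_smul]
      exact mul_le_of_le_one_left (norm_nonneg v) (by simpa using hφ x)
    · simp [hxs, hzero hxU]

theorem exists_compactlySupported_integral_norm_sub_le {ω : Measure X} [ω.Regular] {f : X → E}
    (hf : Integrable f ω) {ε : ℝ} (hε : 0 < ε) :
    ∃ h : C_c(X, E), ∫ x, ‖f x - h x‖ ∂ω ≤ ε := by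
  have hindicator (c : E) ⦃s : Set X⦄ (hs : MeasurableSet s) (hlt : ω s < ∞) {ε : ℝ≥0∞}
      (hε : ε ≠ 0) : ∃ g : X → E, eLpNorm (g - s.indicator fun _ => c) 1 ω ≤ ε ∧
        Continuous g ∧ HasCompactSupport g := by
    obtain ⟨φ, D, hD, hωD, hφ⟩ := exists_compactlySupported_enorm_indicator_sub_le (E := E) ω hs
      hlt.ne (δ := ε / ‖c‖ₑ) (by simp [ENNReal.div_eq_zero_iff, hε])
    refine ⟨fun x => (φ x : ℝ) • c, ?_, by fun_prop,
      φ.hasCompactSupport.comp_left (g := fun r : ℝ≥0 => (r : ℝ) • c) (by simp)⟩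
    calc eLpNorm ((fun x => (φ x : ℝ) • c) - s.indicator fun _ => c) 1 ω
        = ∫⁻ x, ‖s.indicator (fun _ => c) x - (φ x : ℝ) • c‖ₑ ∂ω := by
          rw [eLpNorm_sub_comm, eLpNorm_one_eq_lintegral_enorm]; rfl
      _ ≤ ∫⁻ x, D.indicator (fun _ => ‖c‖ₑ) x ∂ω := lintegral_mono fun x => hφ x c
      _ = ‖c‖ₑ * ω D := lintegral_indicator_const hD _
      _ ≤ ε := by rw [mul_comm]; exact ENNReal.mul_le_of_le_div hωD.le
  have hmeas {h : X → E} (hh : Continuous h ∧ HasCompactSupport h) : AEStronglyMeasurable h ω :=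
    (hh.1.stronglyMeasurable_of_hasCompactSupport hh.2).aestronglyMeasurable
  obtain ⟨h, hle, hh⟩ := MemLp.induction_dense ENNReal.one_ne_top
    (fun h : X → E => Continuous h ∧ HasCompactSupport h) hindicator
    (fun _ _ hf hg => ⟨hf.1.add hg.1, hf.2.add hg.2⟩) (fun _ => hmeas)
    (memLp_one_iff_integrable.2 hf) (ENNReal.ofReal_pos.2 hε).ne'
  exact ⟨⟨⟨h, hh.1⟩, hh.2⟩, (integral_norm_eq_lintegral_enorm (hf.1.sub (hmeas hh))).trans_le <|
    ENNReal.toReal_le_of_le_ofReal hε.le (eLpNorm_one_eq_lintegral_enorm.symm.trans_le hle)⟩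

theorem ae_eq_zero_of_forall_integral_compactlySupported_smul_eq_zero [CompleteSpace E]
    {ω : Measure X} [ω.Regular] {f : X → E} (hf : Integrable f ω)
    (h : ∀ φ : C_c(X, ℝ≥0), ∫ x, (φ x : ℝ) • f x ∂ω = 0) : f =ᵐ[ω] 0 := by
  refine hf.ae_eq_zero_of_forall_setIntegral_eq_zero fun s hs hlt => ?_
  rw [← enorm_eq_zero]
  refine le_antisymm (ENNReal.le_of_forall_pos_le_add fun ε hε _ => ?_) zero_le
  obtain ⟨δ, hδ, hδs⟩ := exists_pos_setLIntegral_lt_of_measure_lt hf.2.ne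
    (ε := (ε : ℝ≥0∞)) (by simpa using hε.ne')
  obtain ⟨φ, D, hD, hωD, hφ⟩ :=
    exists_compactlySupported_enorm_indicator_sub_le (E := E) ω hs hlt.ne hδ.ne'
  have hφf : Integrable (fun x => (φ x : ℝ) • f x) ω := by
    obtain ⟨M, hM⟩ := (φ.hasCompactSupport.comp_left (g := ((↑) : ℝ≥0 → ℝ))
      NNReal.coe_zero).exists_bound_of_continuous (NNReal.continuous_coe.comp φ.continuous)
    exact hf.bdd_smul M (by fun_prop) (.of_forall hM)
  calc ‖∫ x in s, f x ∂ω‖ₑ = ‖∫ x, s.indicator f x - (φ x : ℝ) • f x ∂ω‖ₑ := by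
        rw [integral_sub (hf.indicator hs) hφf, h, sub_zero, integral_indicator hs]
    _ ≤ ∫⁻ x, D.indicator (fun x => ‖f x‖ₑ) x ∂ω :=
        (enorm_integral_le_lintegral_enorm _).trans (lintegral_mono fun x => hφ x (f x))
    _ = ∫⁻ x in D, ‖f x‖ₑ ∂ω := lintegral_indicator hD _
    _ ≤ 0 + ε := by rw [zero_add]; exact (hδs D hωD).le

theorem ae_eq_zero_of_forall_integral_mul_compactlySupported_eq_zero {ω : Measure X} [ω.Regular]
    {f : X → ℂ} (hf : Integrable f ω) (h : ∀ g : C_c(X, ℂ), ∫ x, f x * g x ∂ω = 0) :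
    f =ᵐ[ω] 0 := by
  refine ae_eq_zero_of_forall_integral_compactlySupported_smul_eq_zero hf fun φ => ?_
  simp only [Complex.real_smul, mul_comm]
  exact h ⟨⟨fun x => ((φ x : ℝ) : ℂ), by fun_prop⟩,
    φ.hasCompactSupport.comp_left (g := fun r : ℝ≥0 => ((r : ℝ) : ℂ)) (by simp)⟩

variable [T2Space Y] [LocallyCompactSpace Y] [MeasurableSpace Y] [BorelSpace Y]

theorem aestronglyMeasurable_prod_of_continuous (m : Measure X) (n : Measure Y)
    [IsFiniteMeasure m] [IsFiniteMeasure n] [m.Regular] [n.Regular] {F : X × Y → E}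
    (hF : Continuous F) : AEStronglyMeasurable F (m.prod n) := by
  obtain ⟨C, hC, hm⟩ := exists_seq_isCompact_ae_mem_iUnion m
  obtain ⟨D, hD, hn⟩ := exists_seq_isCompact_ae_mem_iUnion n
  have hcover : (m.prod n).restrict (⋃ k : ℕ × ℕ, C k.1 ×ˢ D k.2) = m.prod n := by
    refine Measure.restrict_eq_self_of_ae_mem ?_
    filter_upwards [Measure.quasiMeasurePreserving_fst.ae hm,
      Measure.quasiMeasurePreserving_snd.ae hn] with p hpC hpD
    obtain ⟨k, hk⟩ := mem_iUnion.1 hpC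
    obtain ⟨l, hl⟩ := mem_iUnion.1 hpD
    exact mem_iUnion.2 ⟨(k, l), hk, hl⟩
  rw [← hcover, aestronglyMeasurable_iUnion_iff]
  intro k
  obtain ⟨φ, hone, -⟩ := exists_compactlySupported_eqOn_one ((hC k.1).prod (hD k.2)) isOpen_univ
    (subset_univ _)
  have hmeas : StronglyMeasurable fun p => (φ p : ℝ) • F p :=
    HasCompactSupport.stronglyMeasurable_of_prod (by fun_prop)
      (φ.hasCompactSupport.mono fun p hp h => hp (by simp [h]))
  refine hmeas.aestronglyMeasurable.congr ?_
  refine (ae_restrict_mem ((hC k.1).measurableSet.prod (hD k.2).measurableSet)).mono fun p hp => ?_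
  simp [hone hp]

theorem integral_integral_swap_of_continuous_of_bounded (m : Measure X) (n : Measure Y)
    [IsFiniteMeasure m] [IsFiniteMeasure n] [m.Regular] [n.Regular] {F : X × Y → ℂ}
    (hF : Continuous F) {M : ℝ} (hM : ∀ p, ‖F p‖ ≤ M) {θ : Y → ℂ} (hθ : Integrable θ n) :
    ∫ x, ∫ y, F (x, y) * θ y ∂n ∂m = ∫ y, (∫ x, F (x, y) ∂m) * θ y ∂n := by
  simp only [← integral_mul_const]
  exact integral_integral_swap ((hθ.comp_snd m).bdd_mul
    (aestronglyMeasurable_prod_of_continuous m n hF) (.of_forall hM))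

theorem integral_integral_swap_of_continuous_of_bounded_compactlySupported (m : Measure X)
    (n : Measure Y) [IsFiniteMeasure m] [m.Regular] [n.Regular] {F : X × Y → ℂ}
    (hF : Continuous F) {M : ℝ} (hM : ∀ p, ‖F p‖ ≤ M) (θ : C_c(Y, ℂ)) :
    ∫ x, ∫ y, F (x, y) * θ y ∂n ∂m = ∫ y, (∫ x, F (x, y) ∂m) * θ y ∂n := by
  have hfin : n (tsupport θ) ≠ ∞ := θ.hasCompactSupport.isCompact.measure_ne_top
  have : IsFiniteMeasure (n.restrict (tsupport θ)) := isFiniteMeasure_restrict.2 hfin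
  have : (n.restrict (tsupport θ)).Regular := Measure.Regular.restrict_of_measure_ne_top hfin
  have hrestrict (u : Y → ℂ) : ∫ y, u y * θ y ∂n = ∫ y in tsupport θ, u y * θ y ∂n :=
    (setIntegral_eq_integral_of_forall_compl_eq_zero fun y hy => by
      rw [image_eq_zero_of_notMem_tsupport hy, mul_zero]).symm
  simp only [hrestrict]
  exact integral_integral_swap_of_continuous_of_bounded m _ hF hM
    (θ.continuous.integrable_of_hasCompactSupport θ.hasCompactSupport)

end Approximation

section ContinuousKernels

open Filter Set
open scoped ENNReal NNReal

variable {X Y : Type*} [TopologicalSpace X] [TopologicalSpace Y]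

theorem eventually_forall_norm_sub_le_add_mul_one_sub {E : Type*} [NormedAddCommGroup E]
    {k : Y → X → E} (hk : Continuous (Function.uncurry k)) {M : ℝ} (hM : ∀ y x, ‖k y x‖ ≤ M)
    (y₀ : Y) {δ : ℝ} (hδ : 0 < δ) {φ : C_c(X, ℝ≥0)} (hφ : ∀ x, φ x ≤ 1) :
    ∀ᶠ y in 𝓝 y₀, ∀ x, ‖k y x - k y₀ x‖ ≤ δ + 2 * M * (1 - φ x) := by
  have hcompact : ∀ᶠ y in 𝓝 y₀, ∀ x ∈ tsupport φ, ‖k y x - k y₀ x‖ < δ := by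
    refine φ.hasCompactSupport.isCompact.eventually_forall_of_forall_eventually fun x _ => ?_
    have hcont : Continuous fun p : Y × X => ‖k p.1 p.2 - k y₀ p.2‖ :=
      (hk.sub (hk.comp (continuous_const.prodMk continuous_snd))).norm
    exact hcont.continuousAt.eventually_lt_const (by simpa using hδ)
  filter_upwards [hcompact] with y hy x
  have hM0 : 0 ≤ M := (norm_nonneg _).trans (hM y x)
  by_cases hx : x ∈ tsupport φ
  · have hφx : 0 ≤ (1 - φ x : ℝ) := sub_nonneg.2 (NNReal.coe_le_one.2 (hφ x))
    exact (hy x hx).le.trans (le_add_of_nonneg_right (by positivity))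
  · rw [image_eq_zero_of_notMem_tsupport hx]
    calc ‖k y x - k y₀ x‖ ≤ M + M := (norm_sub_le _ _).trans (add_le_add (hM y x) (hM y₀ x))
      _ ≤ δ + 2 * M * (1 - (0 : ℝ≥0)) := by rw [NNReal.coe_zero]; linarith

variable [T2Space X] [LocallyCompactSpace X] [MeasurableSpace X] [BorelSpace X]
  {ρ : Y → ProbabilityMeasure X}

theorem lowerSemicontinuous_lintegral_probabilityMeasure (hρ : Continuous ρ)
    (hreg : ∀ y, (ρ y : Measure X).Regular) {F : X → ℝ≥0∞} (hF : LowerSemicontinuous F) :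
    LowerSemicontinuous fun y => ∫⁻ x, F x ∂(ρ y : Measure X) := by
  simp only [fun y : Y => lintegral_eq_iSup_compactMinorants (ρ y : Measure X) hF]
  refine lowerSemicontinuous_iSup fun h => Continuous.lowerSemicontinuous ?_
  refine continuous_iff_continuousAt.2 fun y => ?_
  exact (ProbabilityMeasure.tendsto_iff_forall_lintegral_tendsto.1 hρ.continuousAt)
    h.1.toBoundedContinuousFunction

theorem measurable_probabilityMeasure_of_continuous [MeasurableSpace Y] [BorelSpace Y]
    (hρ : Continuous ρ) (hreg : ∀ y, (ρ y : Measure X).Regular) :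
    Measurable fun y => (ρ y : Measure X) := by
  refine Measurable.measure_of_isPiSystem_of_isProbabilityMeasure
    (BorelSpace.measurable_eq (α := X)) isPiSystem_isOpen fun U hU => ?_
  have hlsc : LowerSemicontinuous (U.indicator (1 : X → ℝ≥0∞)) :=
    hU.lowerSemicontinuous_indicator zero_le
  simpa only [lintegral_indicator_one hU.measurableSet] using
    (lowerSemicontinuous_lintegral_probabilityMeasure hρ hreg hlsc).measurable

theorem exists_compactlySupported_eventually_integral_one_sub_lt (hρ : Continuous ρ) (y₀ : Y)
    [(ρ y₀ : Measure X).Regular] {δ : ℝ} (hδ : 0 < δ) :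
    ∃ φ : C_c(X, ℝ≥0), (∀ x, φ x ≤ 1) ∧
      ∀ᶠ y in 𝓝 y₀, ∫ x, (1 - φ x : ℝ) ∂(ρ y : Measure X) < δ := by
  obtain ⟨C, -, hC, hlt⟩ := MeasurableSet.univ.exists_isCompact_sdiff_lt
    (measure_ne_top (ρ y₀ : Measure X) univ) (ENNReal.ofReal_pos.2 hδ).ne'
  obtain ⟨φ, hone, -, hφ⟩ := exists_compactlySupported_eqOn_one hC isOpen_univ (subset_univ _)
  have hφ0 (x : X) : 0 ≤ (1 - φ x : ℝ) := sub_nonneg.2 (NNReal.coe_le_one.2 (hφ x))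
  have hindicator (x : X) : (1 - φ x : ℝ) ≤ Cᶜ.indicator 1 x := by
    by_cases hx : x ∈ C
    · simp [hx, hone hx]
    · simp [hx]
  have hlt₀ : ∫ x, (1 - φ x : ℝ) ∂(ρ y₀ : Measure X) < δ := calc
    _ ≤ ∫ x, Cᶜ.indicator 1 x ∂(ρ y₀ : Measure X) :=
      integral_mono_of_nonneg (.of_forall hφ0)
        ((integrable_const (1 : ℝ)).indicator hC.measurableSet.compl) (.of_forall hindicator)
    _ = (ρ y₀ : Measure X).real Cᶜ := integral_indicator_one hC.measurableSet.compl
    _ < δ := ENNReal.toReal_lt_of_lt_ofReal (by rwa [compl_eq_univ_sdiff])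
  refine ⟨φ, hφ, (Tendsto.eventually_lt_const hlt₀ ?_)⟩
  exact ProbabilityMeasure.tendsto_iff_forall_integral_tendsto.1 hρ.continuousAt
    (.ofNormedAddCommGroup (fun x => 1 - φ x) (by fun_prop) 1 fun x => by
      rw [Real.norm_eq_abs, abs_of_nonneg (hφ0 x)]
      exact sub_le_self _ (φ x).2)

theorem continuous_integral_probabilityMeasure {𝕜 : Type*} [RCLike 𝕜] (hρ : Continuous ρ)
    (hreg : ∀ y, (ρ y : Measure X).Regular) {k : Y → X → 𝕜} (hk : Continuous (Function.uncurry k))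
    {M : ℝ} (hM : ∀ y x, ‖k y x‖ ≤ M) :
    Continuous fun y => ∫ x, k y x ∂(ρ y : Measure X) := by
  have hky (y : Y) : Continuous (k y) := hk.comp (Continuous.prodMk_right y)
  have hint (y y' : Y) : Integrable (k y) (ρ y' : Measure X) :=
    (BoundedContinuousFunction.ofNormedAddCommGroup (k y) (hky y) M (hM y)).integrable _
  refine continuous_iff_continuousAt.2 fun y₀ => Metric.tendsto_nhds.2 fun ε hε => ?_
  obtain ⟨x₀⟩ := (ρ y₀).nonempty
  have hM0 : 0 ≤ M := (norm_nonneg _).trans (hM y₀ x₀)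
  set δ := ε / (2 + 2 * M)
  have hδ : 0 < δ := by positivity
  obtain ⟨φ, hφ, htight⟩ := exists_compactlySupported_eventually_integral_one_sub_lt hρ y₀ hδ
  have hweak : ∀ᶠ y in 𝓝 y₀,
      dist (∫ x, k y₀ x ∂(ρ y : Measure X)) (∫ x, k y₀ x ∂(ρ y₀ : Measure X)) < δ :=
    Metric.tendsto_nhds.1 ((ProbabilityMeasure.tendsto_iff_forall_integral_rclike_tendsto 𝕜).1
      hρ.continuousAt (.ofNormedAddCommGroup (k y₀) (hky y₀) M (hM y₀))) δ hδ
  filter_upwards [htight, hweak, eventually_forall_norm_sub_le_add_mul_one_sub hk hM y₀ hδ hφ]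
    with y htight hweak hsub
  have hone_sub : Integrable (fun x => (1 - φ x : ℝ)) (ρ y : Measure X) :=
    (integrable_const 1).sub <|
      (NNReal.continuous_coe.comp φ.continuous).integrable_of_hasCompactSupport
        (φ.hasCompactSupport.comp_left NNReal.coe_zero)
  have hdist : dist (∫ x, k y x ∂(ρ y : Measure X)) (∫ x, k y₀ x ∂(ρ y : Measure X)) ≤
      δ + 2 * M * δ := by
    rw [dist_eq_norm, ← integral_sub (hint y y) (hint y₀ y)]
    calc _ ≤ ∫ x, (δ + 2 * M * (1 - φ x)) ∂(ρ y : Measure X) :=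
          norm_integral_le_of_norm_le (by fun_prop) (.of_forall hsub)
      _ = δ + 2 * M * ∫ x, (1 - φ x : ℝ) ∂(ρ y : Measure X) := by
          rw [integral_add (by fun_prop) (by fun_prop), integral_const_mul]
          simp
      _ ≤ δ + 2 * M * δ := by gcongr
  calc _ ≤ _ := dist_triangle _ (∫ x, k y₀ x ∂(ρ y : Measure X)) _
    _ < δ + 2 * M * δ + δ := add_lt_add_of_le_of_lt hdist hweak
    _ = δ * (2 + 2 * M) := by ring
    _ = ε := div_mul_cancel₀ _ (by positivity)

end ContinuousKernels

section SupportSeparation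

open Set
open scoped NNReal

variable {X : Type*} [TopologicalSpace X] [T2Space X] [LocallyCompactSpace X]

theorem subset_of_forall_eqOn_zero {A C : Set X} (hC : IsClosed C)
    (h : ∀ φ : C_c(X, ℝ≥0), EqOn φ 0 C → EqOn φ 0 A) : A ⊆ C := by
  intro t ht
  by_contra htC
  obtain ⟨φ, h1, h0, -⟩ := exists_compactlySupported_eqOn_one isCompact_singleton
    hC.isOpen_compl (singleton_subset_iff.2 htC)
  rw [compl_compl] at h0
  exact one_ne_zero ((h1 rfl).symm.trans (h φ h0 ht))

end SupportSeparation

section MaximumModulus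

variable {X E : Type*} [TopologicalSpace X] [MeasurableSpace X]
  [NormedAddCommGroup E] [NormedSpace ℝ E] [CompleteSpace E] [StrictConvexSpace ℝ E]

theorem eq_integral_of_mem_support_of_le_norm_integral {m : Measure X} [IsProbabilityMeasure m]
    {f : X → E} (hf : Continuous f) {M : ℝ} (hM : ∀ x, ‖f x‖ ≤ M) (h : M ≤ ‖∫ x, f x ∂m‖)
    {x : X} (hx : x ∈ m.support) : f x = ∫ x, f x ∂m := by
  have hae : f =ᵐ[m] Function.const X (∫ x, f x ∂m) := by
    rcases ae_eq_const_or_norm_integral_lt_of_norm_le_const (μ := m) (.of_forall hM) with hc | hlt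
    · simpa only [average_eq_integral] using hc
    · simp only [probReal_univ, one_mul] at hlt
      exact absurd h hlt.not_ge
  exact Measure.support_subset_of_isClosed (isClosed_eq hf continuous_const) hae hx

end MaximumModulus

section KernelContraction

open ProbabilityTheory
open scoped ENNReal

theorem measure_le_of_forall_isOpen_le {X : Type*} [TopologicalSpace X] [MeasurableSpace X]
    {m n : Measure X} [n.OuterRegular] (h : ∀ U, IsOpen U → m U ≤ n U) : m ≤ n := by
  refine Measure.le_iff'.2 fun s => ?_
  rw [s.measure_eq_iInf_isOpen n]
  exact le_iInf₂ fun U hsU => le_iInf fun hU => (measure_mono hsU).trans (h U hU)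

variable {X : Type*} [MeasurableSpace X] {κ : Kernel X X} {ω : Measure X}

theorem lintegral_lintegral_le_of_bind_le (hκ : ω.bind κ ≤ ω) {f : X → ℝ≥0∞}
    (hf : AEMeasurable f ω) : ∫⁻ x, ∫⁻ t, f t ∂κ x ∂ω ≤ ∫⁻ x, f x ∂ω := by
  rw [← Measure.lintegral_bind κ.aemeasurable
    (hf.mono_ac (Measure.absolutelyContinuous_of_le hκ))]
  exact lintegral_mono' hκ le_rfl

theorem ae_ae_eq_of_bind_le {α : Type*} (hκ : ω.bind κ ≤ ω) {f g : X → α} (h : f =ᵐ[ω] g) :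
    ∀ᵐ x ∂ω, f =ᵐ[κ x] g :=
  Measure.ae_ae_of_ae_comp (Measure.absolutelyContinuous_of_le hκ h)

variable {E : Type*} [NormedAddCommGroup E] {f g : X → E}

theorem ae_integrable_of_bind_le (hκ : ω.bind κ ≤ ω) (hf : Integrable f ω) :
    ∀ᵐ x ∂ω, Integrable f (κ x) := by
  have hmk : Measurable fun x => ∫⁻ t, ‖hf.1.mk f t‖ₑ ∂κ x :=
    hf.1.stronglyMeasurable_mk.enorm.lintegral_kernel
  have hfin : ∫⁻ x, ∫⁻ t, ‖hf.1.mk f t‖ₑ ∂κ x ∂ω ≠ ∞ :=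
    ((lintegral_lintegral_le_of_bind_le hκ
      hf.1.stronglyMeasurable_mk.enorm.aemeasurable).trans_lt (hf.congr hf.1.ae_eq_mk).2).ne
  filter_upwards [ae_lt_top hmk hfin, ae_ae_eq_of_bind_le hκ hf.1.ae_eq_mk] with x hx hfx
  exact Integrable.congr ⟨hf.1.stronglyMeasurable_mk.aestronglyMeasurable, hx⟩ hfx.symm

variable [NormedSpace ℝ E]

theorem integrable_integral_of_bind_le (hκ : ω.bind κ ≤ ω) (hf : Integrable f ω) :
    Integrable (fun x => ∫ t, f t ∂κ x) ω := by
  refine ⟨⟨_, hf.1.stronglyMeasurable_mk.integral_kernel (κ := κ), ?_⟩, ?_⟩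
  · filter_upwards [ae_ae_eq_of_bind_le hκ hf.1.ae_eq_mk] with x hx using integral_congr_ae hx
  · exact ((lintegral_mono fun x => enorm_integral_le_lintegral_enorm f).trans
      (lintegral_lintegral_le_of_bind_le hκ hf.1.enorm)).trans_lt hf.2

theorem integral_norm_integral_sub_integral_le_of_bind_le (hκ : ω.bind κ ≤ ω)
    (hf : Integrable f ω) (hg : Integrable g ω) :
    ∫ x, ‖∫ t, f t ∂κ x - ∫ t, g t ∂κ x‖ ∂ω ≤ ∫ x, ‖f x - g x‖ ∂ω := by
  have hsub : Integrable (fun x => f x - g x) ω := hf.sub hg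
  have hsub' : Integrable (fun x => ∫ t, f t ∂κ x - ∫ t, g t ∂κ x) ω :=
    (integrable_integral_of_bind_le hκ hf).sub (integrable_integral_of_bind_le hκ hg)
  rw [integral_norm_eq_lintegral_enorm hsub.1, integral_norm_eq_lintegral_enorm hsub'.1]
  refine ENNReal.toReal_mono hsub.2.ne ?_
  calc ∫⁻ x, ‖∫ t, f t ∂κ x - ∫ t, g t ∂κ x‖ₑ ∂ω
    _ ≤ ∫⁻ x, ∫⁻ t, ‖f t - g t‖ₑ ∂κ x ∂ω := by
      refine lintegral_mono_ae ?_
      filter_upwards [ae_integrable_of_bind_le hκ hf, ae_integrable_of_bind_le hκ hg] with x hf hg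
      rw [← integral_sub hf hg]
      exact enorm_integral_le_lintegral_enorm _
    _ ≤ ∫⁻ x, ‖f x - g x‖ₑ ∂ω := lintegral_lintegral_le_of_bind_le hκ hsub.1.enorm

end KernelContraction

namespace Hypergroup

section Convolution

open Set
open scoped ComplexOrder NNReal

variable {K : Type*} [TopologicalSpace K] [T2Space K] [LocallyCompactSpace K]
  [MeasurableSpace K] [BorelSpace K] [Hypergroup K]

instance regular_conv (x y : K) : (conv x y : Measure K).Regular := conv_regular x y

theorem ae_mem_support_conv (x y : K) :
    ∀ᵐ t ∂(conv x y : Measure K), t ∈ (conv x y : Measure K).support :=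
  Measure.support_mem_ae_of_regular

theorem inv_mem_support_conv {x y t : K} (h : t ∈ (conv x y : Measure K).support) :
    inv t ∈ (conv (inv y) (inv x) : Measure K).support := by
  rw [← map_inv_conv, Measure.mem_support_iff_forall]
  intro U hU
  exact ((Measure.mem_support_iff_forall _).1 h _
    (continuous_inv.continuousAt.preimage_mem_nhds hU)).trans_le
      (Measure.le_map_apply continuous_inv.measurable.aemeasurable _)

theorem mem_setMul {A B : Set K} {t : K} :
    t ∈ setMul A B ↔ ∃ x ∈ A, ∃ y ∈ B, t ∈ (conv x y : Measure K).support := by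
  simp only [setMul, mem_iUnion, exists_prop]

theorem setMul_subset_setMul {A A' B B' : Set K} (hA : A ⊆ A') (hB : B ⊆ B') :
    setMul A B ⊆ setMul A' B' :=
  biUnion_mono hA fun _ _ => biUnion_mono hB fun _ _ => Subset.rfl

theorem isCompact_setMul {A B : Set K} (hA : IsCompact A) (hB : IsCompact B) :
    IsCompact (setMul A B) := by
  let S (p : K × K) : TopologicalSpace.Compacts K := ⟨_, isCompact_support_conv p.1 p.2⟩
  have hS : Continuous S := by
    let := TopologicalSpace.vietoris K
    exact TopologicalSpace.Compacts.isEmbedding_coe.continuous_iff.2 continuous_support_conv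
  convert TopologicalSpace.Compacts.isCompact_biUnion_coe_of_isCompact
    ((hA.prod hB).image hS) using 1
  ext t
  simp only [mem_setMul, S, mem_iUnion, mem_image, exists_prop]
  aesop

theorem norm_translate_le {f : K → ℂ} {M : ℝ} (hM : ∀ t, ‖f t‖ ≤ M) (x y : K) :
    ‖translate f x y‖ ≤ M := by
  simpa only [translate, probReal_univ, mul_one] using
    norm_integral_le_of_norm_le_const (μ := (conv x y : Measure K)) (.of_forall hM)

theorem continuous_translate {f : K → ℂ} (hf : Continuous f) {M : ℝ} (hM : ∀ t, ‖f t‖ ≤ M) :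
    Continuous fun p : K × K => translate f p.1 p.2 :=
  continuous_integral_probabilityMeasure continuous_conv (fun _ => conv_regular _ _)
    (k := fun _ => f) (hf.comp continuous_snd) (fun _ => hM)

theorem continuous_translate_left {f : K → ℂ} (hf : Continuous f) {M : ℝ}
    (hM : ∀ t, ‖f t‖ ≤ M) (x : K) : Continuous (translate f x) :=
  (continuous_translate hf hM).comp (.prodMk_right x)

theorem continuous_translate_right {f : K → ℂ} (hf : Continuous f) {M : ℝ}
    (hM : ∀ t, ‖f t‖ ≤ M) (y : K) : Continuous fun x => translate f x y :=
  (continuous_translate hf hM).comp (.prodMk_left y)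

theorem integrable_conv {f : K → ℂ} (hf : Continuous f) {M : ℝ} (hM : ∀ t, ‖f t‖ ≤ M) (x y : K) :
    Integrable f (conv x y : Measure K) :=
  .of_bound hf.aestronglyMeasurable M (.of_forall hM)

theorem translate_e (f : K → ℂ) (y : K) : translate f e y = f y := by
  rw [translate, e_conv, integral_dirac]

theorem translate_translate {f : K → ℂ} (hf : Continuous f) {M : ℝ} (hM : ∀ t, ‖f t‖ ≤ M)
    (x y z : K) :
    translate (fun t => translate f t z) x y = translate (translate f x) y z :=
  conv_assoc x y z (.ofNormedAddCommGroup f hf M hM)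

theorem exists_mem_support_of_translate_ne_zero {f : K → ℂ} {x y : K}
    (h : translate f x y ≠ 0) : ∃ t ∈ (conv x y : Measure K).support, f t ≠ 0 := by
  contrapose! h
  exact integral_eq_zero_of_ae ((ae_mem_support_conv x y).mono h)

theorem translate_nonneg {f : K → ℂ} (hf : 0 ≤ f) (x y : K) : 0 ≤ translate f x y :=
  integral_nonneg hf

theorem translate_eq_zero_iff {f : K → ℂ} (hf : Continuous f) {M : ℝ} (hM : ∀ t, ‖f t‖ ≤ M)
    (hf0 : 0 ≤ f) {x y : K} :
    translate f x y = 0 ↔ EqOn f 0 (conv x y : Measure K).support := by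
  refine ⟨fun h => ?_, fun h => integral_eq_zero_of_ae ((ae_mem_support_conv x y).mono h)⟩
  have hre : ∫ t, (f t).re ∂(conv x y : Measure K) = 0 := by
    simpa [translate] using (integral_re (integrable_conv hf hM x y)).trans (congrArg Complex.re h)
  have hae : (fun t => (f t).re) =ᵐ[(conv x y : Measure K)] 0 :=
    (integral_eq_zero_iff_of_nonneg (fun t => (Complex.le_def.1 (hf0 t)).1)
      (integrable_conv hf hM x y).re).1 hre
  have hclosed : IsClosed {t | f t = 0} := isClosed_eq hf continuous_const
  refine Measure.support_subset_of_isClosed hclosed (hae.mono fun t ht => ?_)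
  exact Complex.ext ht (Complex.le_def.1 (hf0 t)).2.symm

theorem eqOn_zero_setMul_support_iff {f : K → ℂ} (hf : Continuous f) {M : ℝ}
    (hM : ∀ t, ‖f t‖ ≤ M) (hf0 : 0 ≤ f) (x y z : K) :
    EqOn f 0 (setMul (conv x y : Measure K).support {z}) ↔
      EqOn f 0 (setMul {x} (conv y z : Measure K).support) := by
  have hl : EqOn f 0 (setMul (conv x y : Measure K).support {z}) ↔
      translate (fun t => translate f t z) x y = 0 := by
    rw [translate_eq_zero_iff (continuous_translate_right hf hM z)
      (fun t => norm_translate_le hM t z) (fun t => translate_nonneg hf0 t z)]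
    simp only [setMul, EqOn, mem_iUnion, mem_singleton_iff, iUnion_iUnion_eq_left, Pi.zero_apply,
      translate_eq_zero_iff hf hM hf0, exists_prop]
    grind
  have hr : EqOn f 0 (setMul {x} (conv y z : Measure K).support) ↔
      translate (translate f x) y z = 0 := by
    rw [translate_eq_zero_iff (continuous_translate_left hf hM x)
      (norm_translate_le hM x) (translate_nonneg hf0 x)]
    simp only [setMul, EqOn, mem_iUnion, mem_singleton_iff, iUnion_iUnion_eq_left, Pi.zero_apply,
      translate_eq_zero_iff hf hM hf0, exists_prop]
    grind
  rw [hl, hr, translate_translate hf hM]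

theorem setMul_support_singleton (x y z : K) :
    setMul (conv x y : Measure K).support {z} = setMul {x} (conv y z : Measure K).support := by
  have h (φ : C_c(K, ℝ≥0)) : EqOn φ 0 (setMul (conv x y : Measure K).support {z}) ↔
      EqOn φ 0 (setMul {x} (conv y z : Measure K).support) := by
    have hφ0 : (0 : K → ℂ) ≤ fun s => ((φ s : ℝ) : ℂ) := fun s => by simp
    obtain ⟨M, hM⟩ := φ.toBoundedContinuousFunction.isBounded_range.subset_closedBall 0
    simpa [EqOn] using eqOn_zero_setMul_support_iff (by fun_prop)
      (M := M) (fun s => by simpa [NNReal.dist_eq] using hM (mem_range_self s)) hφ0 x y z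
  exact Subset.antisymm
    (subset_of_forall_eqOn_zero (isCompact_setMul isCompact_singleton
      (isCompact_support_conv y z)).isClosed fun φ => (h φ).2)
    (subset_of_forall_eqOn_zero (isCompact_setMul (isCompact_support_conv x y)
      isCompact_singleton).isClosed fun φ => (h φ).1)

theorem setMul_assoc (A B C : Set K) : setMul (setMul A B) C = setMul A (setMul B C) := by
  ext t
  calc t ∈ setMul (setMul A B) C
    _ ↔ ∃ x ∈ A, ∃ y ∈ B, ∃ z ∈ C, t ∈ setMul (conv x y : Measure K).support {z} := by
      simp only [mem_setMul, mem_singleton_iff]; grind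
    _ ↔ ∃ x ∈ A, ∃ y ∈ B, ∃ z ∈ C, t ∈ setMul {x} (conv y z : Measure K).support := by
      simp only [setMul_support_singleton]
    _ ↔ t ∈ setMul A (setMul B C) := by
      simp only [mem_setMul, mem_singleton_iff]; grind

theorem inv_e : inv (e : K) = e := by
  refine ((e_mem_support_conv e e).1 ?_).symm
  have hae := ae_mem_support_conv (e : K) e
  rw [e_conv, ae_dirac_eq] at hae
  rw [e_conv]
  exact hae

theorem e_mem_support_conv_inv (x : K) : e ∈ (conv x (inv x) : Measure K).support :=
  (e_mem_support_conv x (inv x)).2 (inv_inv x).symm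

theorem mem_support_conv_inv {x y z : K} (h : x ∈ (conv z y : Measure K).support) :
    z ∈ (conv x (inv y) : Measure K).support := by
  have he : e ∈ setMul {z} (setMul {y} {inv x}) := by
    rw [← setMul_assoc]
    exact mem_setMul.2 ⟨x, mem_setMul.2 ⟨z, rfl, y, rfl, h⟩, _, rfl, e_mem_support_conv_inv x⟩
  obtain ⟨_, rfl, s, hs, hes⟩ := mem_setMul.1 he
  obtain ⟨_, rfl, _, rfl, hs⟩ := mem_setMul.1 hs
  simpa only [inv_inv, ← (e_mem_support_conv _ s).1 hes] using inv_mem_support_conv hs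

theorem mem_support_inv_conv {x y z : K} (h : x ∈ (conv z y : Measure K).support) :
    y ∈ (conv (inv z) x : Measure K).support := by
  simpa only [inv_inv] using inv_mem_support_conv (mem_support_conv_inv (inv_mem_support_conv h))

theorem hasCompactSupport_translate {f : K → ℂ} (hf : HasCompactSupport f) (x : K) :
    HasCompactSupport (translate f x) := by
  refine .intro (isCompact_setMul (isCompact_singleton (x := inv x)) hf) fun y hy => ?_
  by_contra hne
  obtain ⟨t, ht, hft⟩ := exists_mem_support_of_translate_ne_zero hne
  exact hy (mem_setMul.2 ⟨_, rfl, t, subset_tsupport _ hft, mem_support_inv_conv ht⟩)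

theorem mem_setMul_of_translate_ne_zero {f : K → ℂ} {C : Set K} {x y : K} (hy : y ∈ C)
    (h : translate f x y ≠ 0) : x ∈ setMul (tsupport f) (inv '' C) := by
  obtain ⟨t, ht, hft⟩ := exists_mem_support_of_translate_ne_zero h
  exact mem_setMul.2 ⟨t, subset_tsupport _ hft, _, mem_image_of_mem _ hy, mem_support_conv_inv ht⟩

end Convolution

section MaximumPrinciple

open Set Filter

variable {K : Type*} [TopologicalSpace K] [T2Space K] [LocallyCompactSpace K]
  [MeasurableSpace K] [BorelSpace K] [Hypergroup K] {σ : Measure K} [IsProbabilityMeasure σ]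
  {f : K → ℂ} {M : ℝ}

theorem translate_eq_iff_of_forall_norm_le_norm (hf : Continuous f) {z₀ : K}
    (hz₀ : ∀ x, ‖f x‖ ≤ ‖f z₀‖) {x y : K} :
    translate f x y = f z₀ ↔ ∀ t ∈ (conv x y : Measure K).support, f t = f z₀ := by
  refine ⟨fun h t ht => ?_, fun h => ?_⟩
  · rw [← h]
    exact eq_integral_of_mem_support_of_le_norm_integral hf hz₀ (congrArg norm h).ge ht
  · rw [translate, integral_congr_ae ((ae_mem_support_conv x y).mono h), integral_const,
      probReal_univ, one_smul]

theorem eq_of_harmonic_of_forall_norm_le_norm (hσ : IsNondegenerate σ) (hf : Continuous f)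
    (hharm : ∀ z, ∫ x, translate f z x ∂σ = f z) {z₀ : K} (hz₀ : ∀ x, ‖f x‖ ≤ ‖f z₀‖) (x : K) :
    f x = f z₀ := by
  let S := {z | f z = f z₀}
  have mem_S_iff {z y : K} : translate f z y = f z₀ ↔ (conv z y : Measure K).support ⊆ S :=
    translate_eq_iff_of_forall_norm_le_norm hf hz₀
  have hSσ : setMul S σ.support ⊆ S := by
    refine iUnion₂_subset fun z hz => iUnion₂_subset fun y hy => mem_S_iff.1 ?_
    have hmean : ∫ x, translate f z x ∂σ = f z₀ := (hharm z).trans hz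
    rw [← hmean]
    exact eq_integral_of_mem_support_of_le_norm_integral (continuous_translate_left hf hz₀ z)
      (norm_translate_le hz₀ z) (congrArg norm hmean).ge hy
  have hSpow (n : ℕ) : setMul S (setPowSucc σ.support n) ⊆ S := by
    induction n with
    | zero => exact hSσ
    | succ n ih =>
      rw [setPowSucc, ← setMul_assoc]
      exact (setMul_subset_setMul ih Subset.rfl).trans hSσ
  have hS {z : K} (hz : z ∈ S) (y : K) : (conv z y : Measure K).support ⊆ S := by
    have hclosed : IsClosed {y | translate f z y = f z₀} :=
      isClosed_eq (continuous_translate_left hf hz₀ z) continuous_const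
    refine mem_S_iff.1 (hclosed.closure_subset_iff.2 ?_ (hσ.ge (mem_univ y)))
    exact iUnion_subset fun n y hy => mem_S_iff.2 fun t ht =>
      hSpow n (mem_setMul.2 ⟨z, hz, y, hy, ht⟩)
  have he : e ∈ S := hS (z := z₀) rfl (inv z₀) (e_mem_support_conv_inv z₀)
  rw [← translate_e f x]
  exact mem_S_iff.2 (hS he x)

theorem eq_zero_of_harmonic [NoncompactSpace K] (hσ : IsNondegenerate σ) (F : C₀(K, ℂ))
    (hharm : ∀ z, ∫ x, translate F z x ∂σ = F z) : F = 0 := by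
  ext w
  by_contra hw
  have hlim : Tendsto F (cocompact K) (𝓝 0) := zero_at_infty F
  obtain ⟨z₀, hz₀⟩ := F.continuous.norm.exists_forall_ge' w
    ((hlim.norm.eventually_lt_const (by simpa using hw)).mono fun x hx => hx.le)
  have hconst : ⇑F = fun _ => F z₀ :=
    funext (eq_of_harmonic_of_forall_norm_le_norm hσ F.continuous hharm hz₀)
  rw [hconst] at hw hlim
  exact hw (tendsto_nhds_unique tendsto_const_nhds hlim)

end MaximumPrinciple

section CIntegral

variable {X : Type*} [TopologicalSpace X] [MeasurableSpace X] [BorelSpace X]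

theorem cintegral_eq_integral_mul_rnDeriv_of_bounded (μ : ComplexMeasure X) {f : X → ℂ}
    (hf : Continuous f) {M : ℝ} (hM : ∀ x, ‖f x‖ ≤ M) :
    cintegral μ f = ∫ x, f x * μ.rnDeriv μ.variation x ∂μ.variation :=
  cintegral_eq_integral_mul_rnDeriv μ (.of_bound hf.aestronglyMeasurable M (.of_forall hM))

variable [T2Space X] [LocallyCompactSpace X]

theorem eq_zero_of_forall_cintegral_eq_zero {μ : ComplexMeasure X} (hμ : IsRegularMeasure μ)
    (h : ∀ f : C_c(X, ℂ), cintegral μ f = 0) : μ = 0 := by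
  have : μ.variation.Regular := hμ
  have hθ : μ.rnDeriv μ.variation =ᵐ[μ.variation] 0 := by
    refine ae_eq_zero_of_forall_integral_mul_compactlySupported_eq_zero
      (ComplexMeasure.integrable_rnDeriv _ _) fun g => ?_
    obtain ⟨M, hM⟩ := g.hasCompactSupport.exists_bound_of_continuous g.continuous
    simpa only [cintegral_eq_integral_mul_rnDeriv_of_bounded μ (map_continuous g) hM, mul_comm]
      using h g
  rw [← withDensityᵥ_rnDeriv_variation μ, WithDensityᵥEq.congr_ae hθ, withDensityᵥ_zero]

end CIntegral

section TranslatePairing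

open Set

variable {K : Type*} [TopologicalSpace K] [T2Space K] [LocallyCompactSpace K]
  [MeasurableSpace K] [BorelSpace K] [Hypergroup K]

theorem exists_compactlySupported_eq_integral_translate_mul (ν : Measure K)
    [IsFiniteMeasureOnCompacts ν] (f h : C_c(K, ℂ)) :
    ∃ G : C_c(K, ℂ), ∀ z, G z = ∫ y, translate f z y * h y ∂ν := by
  obtain ⟨M, hM⟩ := f.hasCompactSupport.exists_bound_of_continuous f.continuous
  have hcont : Continuous fun z => ∫ y, translate f z y * h y ∂ν := by
    rw [← continuousOn_univ]
    refine continuousOn_integral_of_compact_support h.hasCompactSupport.isCompact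
      ((continuous_translate f.continuous hM).mul
        (h.continuous.comp continuous_snd)).continuousOn fun z y _ hy => ?_
    rw [image_eq_zero_of_notMem_tsupport hy, mul_zero]
  refine ⟨⟨⟨_, hcont⟩, .intro (isCompact_setMul f.hasCompactSupport.isCompact
    (h.hasCompactSupport.isCompact.image continuous_inv)) fun z hz => ?_⟩, fun _ => rfl⟩
  refine integral_eq_zero_of_ae (.of_forall fun y => ?_)
  by_contra hne
  obtain ⟨hf, hh⟩ := mul_ne_zero_iff.1 hne
  exact hz (mem_setMul_of_translate_ne_zero (subset_tsupport _ hh) hf)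

theorem exists_zeroAtInfty_eq_integral_translate_mul {ν : Measure K} [ν.Regular]
    (f : C_c(K, ℂ)) {θ : K → ℂ} (hθ : Integrable θ ν) :
    ∃ G : C₀(K, ℂ), ⇑G = fun z => ∫ y, translate f z y * θ y ∂ν := by
  obtain ⟨M, hM⟩ := f.hasCompactSupport.exists_bound_of_continuous f.continuous
  have hM0 : 0 ≤ M := (norm_nonneg _).trans (hM e)
  have hint {θ : K → ℂ} (hθ : Integrable θ ν) (z : K) :
      Integrable (fun y => translate f z y * θ y) ν :=
    hθ.bdd_mul (continuous_translate_left f.continuous hM z).aestronglyMeasurable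
      (.of_forall (norm_translate_le hM z))
  refine exists_zeroAtInfty_eq_of_forall_norm_sub_le fun ε hε => ?_
  obtain ⟨h, hh⟩ := exists_compactlySupported_integral_norm_sub_le hθ
    (by positivity : 0 < ε / (M + 1))
  have hhint : Integrable h ν := h.continuous.integrable_of_hasCompactSupport h.hasCompactSupport
  obtain ⟨G, hG⟩ := exists_compactlySupported_eq_integral_translate_mul ν f h
  refine ⟨G, fun z => ?_⟩
  calc ‖∫ y, translate f z y * θ y ∂ν - G z‖
    _ = ‖∫ y, translate f z y * (θ y - h y) ∂ν‖ := by
      simp only [hG, mul_sub, integral_sub (hint hθ z) (hint hhint z)]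
    _ ≤ ∫ y, M * ‖θ y - h y‖ ∂ν := by
      refine norm_integral_le_of_norm_le ((hθ.sub hhint).norm.const_mul M) (.of_forall fun y => ?_)
      rw [norm_mul]
      gcongr
      exact norm_translate_le hM z y
    _ = M * ∫ y, ‖θ y - h y‖ ∂ν := integral_const_mul _ _
    _ ≤ M * (ε / (M + 1)) := by gcongr
    _ ≤ ε := by
      rw [mul_div_assoc', div_le_iff₀ (by positivity)]
      linarith

end TranslatePairing

section HarmonicMeasures

open Set

variable {K : Type*} [TopologicalSpace K] [T2Space K] [LocallyCompactSpace K]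
  [MeasurableSpace K] [BorelSpace K] [Hypergroup K]

theorem integral_translate_cintegral_translate {σ : Measure K} [IsProbabilityMeasure σ]
    [σ.Regular] {μ : ComplexMeasure K} (hμ : IsRegularMeasure μ) {f : K → ℂ} (hf : Continuous f)
    {M : ℝ} (hM : ∀ x, ‖f x‖ ≤ M) (z : K) :
    ∫ x, translate (fun t => cintegral μ (translate f t)) z x ∂σ =
      cintegral μ fun y => ∫ x, translate (translate f z) x y ∂σ := by
  have : μ.variation.Regular := hμ
  set θ := μ.rnDeriv μ.variation
  have hθ : Integrable θ μ.variation := ComplexMeasure.integrable_rnDeriv _ _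
  have hfz := continuous_translate_left hf hM z
  have hMz := norm_translate_le hM z
  have hcont : Continuous fun y => ∫ x, translate (translate f z) x y ∂σ :=
    continuous_integral_probabilityMeasure (ρ := fun _ => ⟨σ, inferInstance⟩) continuous_const
      (fun _ => ‹σ.Regular›) ((continuous_translate hfz hMz).comp continuous_swap)
      fun y x => norm_translate_le hMz x y
  have hinner (x : K) : translate (fun t => cintegral μ (translate f t)) z x =
      ∫ y, translate (translate f z) x y * θ y ∂μ.variation := by
    simp only [cintegral_eq_integral_mul_rnDeriv_of_bounded μ (continuous_translate_left hf hM _)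
      (norm_translate_le hM _)]
    simp only [← translate_translate hf hM]
    exact integral_integral_swap_of_continuous_of_bounded _ _ (continuous_translate hf hM)
      (fun p => norm_translate_le hM p.1 p.2) hθ
  simp only [hinner]
  rw [integral_integral_swap_of_continuous_of_bounded _ _ (continuous_translate hfz hMz)
      (fun p => norm_translate_le hMz p.1 p.2) hθ,
    cintegral_eq_integral_mul_rnDeriv_of_bounded μ hcont fun y =>
      norm_integral_le_of_norm_le_const (.of_forall fun x => norm_translate_le hMz x y)]

theorem cintegral_eq_zero_of_mem_harmonicMeasures [NoncompactSpace K] {σ : Measure K}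
    [IsProbabilityMeasure σ] [σ.Regular] (hσ : IsNondegenerate σ) {μ : ComplexMeasure K}
    (hμ : μ ∈ harmonicMeasures σ) (f : C_c(K, ℂ)) : cintegral μ f = 0 := by
  obtain ⟨hreg, -, hconv⟩ := hμ
  have : μ.variation.Regular := hreg
  obtain ⟨M, hM⟩ := f.hasCompactSupport.exists_bound_of_continuous f.continuous
  have hfz := continuous_translate_left (map_continuous f) hM
  obtain ⟨G, hG⟩ : ∃ G : C₀(K, ℂ), ⇑G = fun z => cintegral μ (translate f z) := by
    simp only [cintegral_eq_integral_mul_rnDeriv_of_bounded μ (hfz _) (norm_translate_le hM _)]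
    exact exists_zeroAtInfty_eq_integral_translate_mul f (ComplexMeasure.integrable_rnDeriv _ _)
  have hharm (z : K) : ∫ x, translate G z x ∂σ = G z := by
    simp only [hG]
    rw [integral_translate_cintegral_translate hreg (map_continuous f) hM]
    exact (hconv ⟨⟨translate f z, hfz z⟩,
      (hasCompactSupport_translate f.hasCompactSupport z).is_zero_at_infty⟩).symm
  have he : G e = cintegral μ (translate f e) := congrFun hG e
  rwa [eq_zero_of_harmonic hσ G hharm, funext (translate_e f), ZeroAtInftyContinuousMap.zero_apply,
    eq_comm] at he

theorem zero_mem_harmonicMeasures (σ : Measure K) : 0 ∈ harmonicMeasures σ := by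
  have hreg : IsRegularMeasure (0 : ComplexMeasure K) := by
    rw [IsRegularMeasure, VectorMeasure.variation_zero]
    infer_instance
  exact ⟨hreg, hreg, fun f => by simp [cintegral, VectorMeasure.integral_zero_vectorMeasure]⟩

theorem harmonicMeasures_eq_zero [NoncompactSpace K] {σ : Measure K} [IsProbabilityMeasure σ]
    [σ.Regular] (hσ : IsNondegenerate σ) : harmonicMeasures σ = {0} :=
  Subset.antisymm
    (fun _ hμ => eq_zero_of_forall_cintegral_eq_zero hμ.1
      (cintegral_eq_zero_of_mem_harmonicMeasures hσ hμ))
    (singleton_subset_iff.2 (zero_mem_harmonicMeasures σ))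

end HarmonicMeasures

section HaarContraction

open ProbabilityTheory Set
open scoped ENNReal NNReal

variable {K : Type*} [TopologicalSpace K] [T2Space K] [LocallyCompactSpace K]
  [MeasurableSpace K] [BorelSpace K] [Hypergroup K]

theorem lowerSemicontinuous_lintegral_conv {F : K → ℝ≥0∞} (hF : LowerSemicontinuous F) :
    LowerSemicontinuous fun p : K × K => ∫⁻ t, F t ∂(conv p.1 p.2 : Measure K) :=
  lowerSemicontinuous_lintegral_probabilityMeasure continuous_conv (fun _ => inferInstance) hF

/-- The Markov kernel `y ↦ δ_z * δ_y`, whose action on functions is `translate · z`. -/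
def convKernel (z : K) : Kernel K K where
  toFun y := conv z y
  measurable' := measurable_probabilityMeasure_of_continuous
    (continuous_conv.comp (Continuous.prodMk_right z)) fun _ => inferInstance

/-- The Markov kernel `y ↦ δ_y̌ * δ_x`. -/
def convInvKernel (x : K) : Kernel K K where
  toFun y := conv (inv y) x
  measurable' := measurable_probabilityMeasure_of_continuous
    (continuous_conv.comp (continuous_inv.prodMk continuous_const)) fun _ => inferInstance

instance isMarkovKernel_convInvKernel (x : K) : IsMarkovKernel (convInvKernel x) :=
  ⟨fun y => inferInstanceAs (IsProbabilityMeasure (conv (inv y) x : Measure K))⟩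

theorem lowerSemicontinuous_lintegral_convInvKernel {F : K → ℝ≥0∞} (hF : LowerSemicontinuous F) :
    LowerSemicontinuous fun p : K × K => ∫⁻ t, F t ∂convInvKernel p.1 p.2 :=
  (lowerSemicontinuous_lintegral_conv hF).comp
    ((continuous_inv.comp continuous_snd).prodMk continuous_fst)

theorem lowerSemicontinuous_lintegral_bind_convInvKernel (σ : Measure K) [σ.Regular]
    {F : K → ℝ≥0∞} (hF : LowerSemicontinuous F) :
    LowerSemicontinuous fun x => ∫⁻ t, F t ∂σ.bind (convInvKernel x) := by
  simp only [fun x : K => Measure.lintegral_bind (m := σ) (convInvKernel x).aemeasurable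
    hF.measurable.aemeasurable]
  exact lowerSemicontinuous_lintegral_prodMk σ (lowerSemicontinuous_lintegral_convInvKernel hF)

variable (σ : Measure K) [IsProbabilityMeasure σ] [σ.Regular]

/-- The Markov kernel whose action on functions is `convFun σ`. -/
noncomputable def convFunKernel : Kernel K K where
  toFun x := σ.bind (convInvKernel x)
  measurable' := by
    refine Measurable.measure_of_isPiSystem_of_isProbabilityMeasure
      (BorelSpace.measurable_eq (α := K)) isPiSystem_isOpen fun U hU => ?_
    have hlsc : LowerSemicontinuous (U.indicator (1 : K → ℝ≥0∞)) :=
      hU.lowerSemicontinuous_indicator zero_le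
    simpa only [lintegral_indicator_one hU.measurableSet] using
      (lowerSemicontinuous_lintegral_bind_convInvKernel σ hlsc).measurable

variable {ω : Measure K}

theorem IsLeftHaar.lintegral_lintegral_conv_compactlySupported (hω : IsLeftHaar ω) (z : K)
    (h : C_c(K, ℝ≥0)) : ∫⁻ y, ∫⁻ t, h t ∂(conv z y : Measure K) ∂ω = ∫⁻ y, h y ∂ω := by
  have := hω.regular
  have hcont : Continuous fun t => (h t : ℝ) := NNReal.continuous_coe.comp h.continuous
  have hcompact : HasCompactSupport fun t => (h t : ℝ) :=
    h.hasCompactSupport.comp_left NNReal.coe_zero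
  have hint (ν : Measure K) [IsFiniteMeasureOnCompacts ν] : Integrable (fun t => (h t : ℝ)) ν :=
    hcont.integrable_of_hasCompactSupport hcompact
  let f : C_c(K, ℂ) := ⟨⟨fun t => ((h t : ℝ) : ℂ), Complex.continuous_ofReal.comp hcont⟩,
    hcompact.comp_left (g := Complex.ofReal) Complex.ofReal_zero⟩
  have hf (y : K) : translate f z y = ((∫ t, (h t : ℝ) ∂(conv z y : Measure K) : ℝ) : ℂ) :=
    integral_complex_ofReal
  obtain ⟨M, hM⟩ := f.hasCompactSupport.exists_bound_of_continuous f.continuous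
  have hint_translate : Integrable (fun y => ∫ t, (h t : ℝ) ∂(conv z y : Measure K)) ω := by
    simpa only [hf, RCLike.re_to_complex, Complex.ofReal_re] using
      ((continuous_translate_left (map_continuous f) hM z).integrable_of_hasCompactSupport
        (hasCompactSupport_translate f.hasCompactSupport z)).re
  have hinvariant : ∫ y, ∫ t, (h t : ℝ) ∂(conv z y : Measure K) ∂ω = ∫ y, (h y : ℝ) ∂ω := by
    have := hω.left_invariant z f
    simp only [hf, integral_complex_ofReal] at this
    exact Complex.ofReal_injective (this.trans integral_complex_ofReal)
  simp only [lintegral_coe_eq_integral _ (hint _)]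
  rw [← hinvariant, ofReal_integral_eq_lintegral_ofReal hint_translate
    (.of_forall fun y => integral_nonneg fun t => (h t).2)]

theorem IsLeftHaar.lintegral_lintegral_conv_of_lowerSemicontinuous (hω : IsLeftHaar ω) (z : K)
    {F : K → ℝ≥0∞} (hF : LowerSemicontinuous F) :
    ∫⁻ y, ∫⁻ t, F t ∂(conv z y : Measure K) ∂ω = ∫⁻ y, F y ∂ω := by
  have := hω.regular
  simp only [lintegral_eq_iSup_compactMinorants _ hF,
    ← hω.lintegral_lintegral_conv_compactlySupported z]
  refine lintegral_iSup_of_lowerSemicontinuous ω (fun h => ?_) ?_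
  · exact (lowerSemicontinuous_lintegral_conv
      (ENNReal.continuous_coe.comp h.1.continuous).lowerSemicontinuous).comp
        (Continuous.prodMk_right z)
  · intro g h
    obtain ⟨u, hgu, hhu⟩ := directed_compactMinorants F g h
    exact ⟨u, fun y => lintegral_mono hgu, fun y => lintegral_mono hhu⟩

theorem IsLeftHaar.bind_convKernel_le (hω : IsLeftHaar ω) (z : K) :
    ω.bind (convKernel z) ≤ ω := by
  have := hω.regular
  refine measure_le_of_forall_isOpen_le fun U hU => ?_
  rw [Measure.bind_apply hU.measurableSet (convKernel z).aemeasurable,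
    ← lintegral_indicator_one hU.measurableSet]
  simp only [← lintegral_indicator_one hU.measurableSet]
  exact (hω.lintegral_lintegral_conv_of_lowerSemicontinuous z
    (hU.lowerSemicontinuous_indicator zero_le)).le

theorem IsLeftHaar.bind_convFunKernel_le (hω : IsLeftHaar ω) : ω.bind (convFunKernel σ) ≤ ω := by
  have := hω.regular
  refine measure_le_of_forall_isOpen_le fun U hU => ?_
  have hlsc : LowerSemicontinuous (U.indicator (1 : K → ℝ≥0∞)) :=
    hU.lowerSemicontinuous_indicator zero_le
  calc ω.bind (convFunKernel σ) U
    _ = ∫⁻ x, ∫⁻ y, ∫⁻ t, U.indicator 1 t ∂convInvKernel x y ∂σ ∂ω := by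
      rw [← lintegral_indicator_one hU.measurableSet, Measure.lintegral_bind
        (convFunKernel σ).aemeasurable hlsc.measurable.aemeasurable]
      exact lintegral_congr fun x => Measure.lintegral_bind (convInvKernel x).aemeasurable
        hlsc.measurable.aemeasurable
    _ = ∫⁻ y, ∫⁻ x, ∫⁻ t, U.indicator 1 t ∂convInvKernel x y ∂ω ∂σ :=
      lintegral_lintegral_swap_of_lowerSemicontinuous ω σ
        (lowerSemicontinuous_lintegral_convInvKernel hlsc)
    _ = ∫⁻ _, ω U ∂σ := lintegral_congr fun y =>
      (hω.lintegral_lintegral_conv_of_lowerSemicontinuous (inv y) hlsc).trans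
        (lintegral_indicator_one hU.measurableSet)
    _ ≤ ω U := by simp

end HaarContraction

section ConvFun

open ProbabilityTheory Set

variable {K : Type*} [TopologicalSpace K] [T2Space K] [LocallyCompactSpace K]
  [MeasurableSpace K] [BorelSpace K] [Hypergroup K] {ω σ : Measure K} [IsProbabilityMeasure σ]
  {k l : K → ℂ}

theorem norm_integral_translate_sub_le (f g : K →ᵇ ℂ) {c : ℝ} (h : ∀ t, ‖f t - g t‖ ≤ c)
    (z : K) : ‖∫ x, translate f z x ∂σ - ∫ x, translate g z x ∂σ‖ ≤ c := by
  have hint (u : K →ᵇ ℂ) : Integrable (translate u z) σ :=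
    .of_bound (continuous_translate_left u.continuous u.norm_coe_le_norm z).aestronglyMeasurable _
      (.of_forall (norm_translate_le u.norm_coe_le_norm z))
  have hsub (x : K) : translate f z x - translate g z x = translate (f - g) z x :=
    (integral_sub (f.integrable _) (g.integrable _)).symm
  rw [← integral_sub (hint f) (hint g)]
  refine (norm_integral_le_of_norm_le_const (.of_forall fun x => ?_)).trans_eq
    (by rw [probReal_univ, mul_one])
  rw [hsub]
  exact norm_translate_le h z x

variable [σ.Regular]

theorem convFun_eq_integral_convFunKernel {x : K} (hk : Integrable k (convFunKernel σ x)) :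
    convFun σ k x = ∫ t, k t ∂convFunKernel σ x := by
  have hcomp : convFunKernel σ x = (convInvKernel x ∘ₖ Kernel.const Unit σ) () :=
    Measure.comp_eq_comp_const_apply
  rw [hcomp] at hk ⊢
  rw [Kernel.integral_comp hk, Kernel.const_apply]
  rfl

theorem IsLeftHaar.convFun_ae_eq (hω : IsLeftHaar ω) (hk : Integrable k ω) :
    convFun σ k =ᵐ[ω] fun x => ∫ t, k t ∂convFunKernel σ x :=
  (ae_integrable_of_bind_le (hω.bind_convFunKernel_le σ) hk).mono fun _ =>
    convFun_eq_integral_convFunKernel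

theorem IsLeftHaar.convFun_congr_ae (hω : IsLeftHaar ω) (hk : Integrable k ω) (h : k =ᵐ[ω] l) :
    convFun σ k =ᵐ[ω] convFun σ l := by
  filter_upwards [hω.convFun_ae_eq (σ := σ) hk, hω.convFun_ae_eq (σ := σ) (hk.congr h),
    ae_ae_eq_of_bind_le (hω.bind_convFunKernel_le σ) h] with x hkx hlx hkl
  rw [hkx, hlx, integral_congr_ae hkl]

theorem IsLeftHaar.integrable_convFun (hω : IsLeftHaar ω) (hk : Integrable k ω) :
    Integrable (convFun σ k) ω :=
  (integrable_integral_of_bind_le (hω.bind_convFunKernel_le σ) hk).congr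
    (hω.convFun_ae_eq hk).symm

theorem IsLeftHaar.integral_norm_convFun_sub_le (hω : IsLeftHaar ω) (hk : Integrable k ω)
    (hl : Integrable l ω) :
    ∫ x, ‖convFun σ k x - convFun σ l x‖ ∂ω ≤ ∫ x, ‖k x - l x‖ ∂ω := by
  refine (integral_congr_ae ?_).trans_le (integral_norm_integral_sub_integral_le_of_bind_le
    (hω.bind_convFunKernel_le σ) hk hl)
  filter_upwards [hω.convFun_ae_eq (σ := σ) hk, hω.convFun_ae_eq (σ := σ) hl] with x hkx hlx
  rw [hkx, hlx]

theorem translate_convFun {h : K → ℂ} (hh : Continuous h) {M : ℝ} (hM : ∀ x, ‖h x‖ ≤ M)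
    (w y : K) :
    translate (convFun σ h) w y = ∫ x, translate (translate h (inv x)) w y ∂σ := by
  have hcont : Continuous fun p : K × K => translate h (inv p.2) p.1 :=
    (continuous_translate hh hM).comp ((continuous_inv.comp continuous_snd).prodMk continuous_fst)
  have hswap := integral_integral_swap_of_continuous_of_bounded (conv w y : Measure K) σ hcont
    (fun _ => norm_translate_le hM _ _) (integrable_const (1 : ℂ))
  simp only [mul_one] at hswap
  exact hswap

end ConvFun

section HaarPairing

open ProbabilityTheory Set

variable {K : Type*} [TopologicalSpace K] [T2Space K] [LocallyCompactSpace K]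
  [MeasurableSpace K] [BorelSpace K] [Hypergroup K] {ω σ : Measure K} [IsProbabilityMeasure σ]
  [σ.Regular] {k l : K → ℂ}

/-- The pairing `z ↦ ∫ k(ž * y) g(y) dω(y)` of the translates of `k` with a test function `g`. It
turns a `σ`-harmonic `k` into a harmonic function vanishing at infinity; the translation by `ž`
rather than by `z` matches the convolution `σ * k`, which is an average of `k(x̌ * ·)`. -/
noncomputable def haarPairing (ω : Measure K) (g : C_c(K, ℂ)) (k : K → ℂ) (z : K) : ℂ :=
  ∫ y, translate k (inv z) y * g y ∂ω

variable (g : C_c(K, ℂ))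

theorem IsLeftHaar.haarPairing_congr_ae (hω : IsLeftHaar ω) (h : k =ᵐ[ω] l) :
    haarPairing ω g k = haarPairing ω g l := by
  funext z
  refine integral_congr_ae ?_
  filter_upwards [ae_ae_eq_of_bind_le (hω.bind_convKernel_le (inv z)) h] with y hy
  exact congrArg (· * g y) (integral_congr_ae hy)

theorem exists_forall_norm_haarPairing_sub_le (hω : IsLeftHaar ω) : ∃ M, 0 ≤ M ∧ ∀ k l : K → ℂ,
    Integrable k ω → Integrable l ω → ∀ z,
      ‖haarPairing ω g k z - haarPairing ω g l z‖ ≤ M * ∫ y, ‖k y - l y‖ ∂ω := by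
  obtain ⟨M, hM⟩ := g.hasCompactSupport.exists_bound_of_continuous g.continuous
  have hM0 : 0 ≤ M := (norm_nonneg _).trans (hM e)
  refine ⟨M, hM0, fun k l hk hl z => ?_⟩
  have hκ := hω.bind_convKernel_le (inv z)
  have hint {u : K → ℂ} (hu : Integrable u ω) : Integrable (translate u (inv z)) ω :=
    integrable_integral_of_bind_le hκ hu
  have hmul {u : K → ℂ} (hu : Integrable u ω) :
      Integrable (fun y => translate u (inv z) y * g y) ω :=
    (hint hu).mul_bdd (map_continuous g).aestronglyMeasurable (.of_forall hM)
  calc ‖haarPairing ω g k z - haarPairing ω g l z‖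
    _ = ‖∫ y, (translate k (inv z) y - translate l (inv z) y) * g y ∂ω‖ := by
      simp only [haarPairing, sub_mul, integral_sub (hmul hk) (hmul hl)]
    _ ≤ ∫ y, M * ‖translate k (inv z) y - translate l (inv z) y‖ ∂ω := by
      refine norm_integral_le_of_norm_le (((hint hk).sub (hint hl)).norm.const_mul M)
        (.of_forall fun y => ?_)
      rw [norm_mul, mul_comm]
      gcongr
      exact hM y
    _ = M * ∫ y, ‖translate k (inv z) y - translate l (inv z) y‖ ∂ω := integral_const_mul _ _
    _ ≤ M * ∫ y, ‖k y - l y‖ ∂ω := mul_le_mul_of_nonneg_left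
      (integral_norm_integral_sub_integral_le_of_bind_le hκ hk hl) hM0

theorem exists_compactlySupported_eq_haarPairing (hω : IsLeftHaar ω) (h : C_c(K, ℂ)) :
    ∃ G : C_c(K, ℂ), ⇑G = haarPairing ω g h := by
  have := hω.regular
  obtain ⟨G, hG⟩ := exists_compactlySupported_eq_integral_translate_mul ω h g
  let invHomeo : K ≃ₜ K := Homeomorph.mk ⟨inv, inv, inv_inv, inv_inv⟩ continuous_inv continuous_inv
  exact ⟨⟨⟨_, (map_continuous G).comp continuous_inv⟩,
    G.hasCompactSupport.comp_homeomorph invHomeo⟩, funext fun z => hG (inv z)⟩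

theorem exists_zeroAtInfty_eq_haarPairing (hω : IsLeftHaar ω) (hk : Integrable k ω) :
    ∃ F : C₀(K, ℂ), ⇑F = haarPairing ω g k := by
  have := hω.regular
  obtain ⟨M, hM0, hM⟩ := exists_forall_norm_haarPairing_sub_le g hω
  refine exists_zeroAtInfty_eq_of_forall_norm_sub_le fun ε hε => ?_
  obtain ⟨h, hh⟩ := exists_compactlySupported_integral_norm_sub_le hk
    (by positivity : 0 < ε / (M + 1))
  obtain ⟨G, hG⟩ := exists_compactlySupported_eq_haarPairing g hω h
  refine ⟨G, fun z => ?_⟩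
  calc ‖haarPairing ω g k z - G z‖
    _ ≤ M * ∫ y, ‖k y - h y‖ ∂ω := hG ▸ hM k h hk
      (h.continuous.integrable_of_hasCompactSupport h.hasCompactSupport) z
    _ ≤ M * (ε / (M + 1)) := by gcongr
    _ ≤ ε := by
      rw [mul_div_assoc', div_le_iff₀ (by positivity)]
      linarith

theorem translate_haarPairing [ω.Regular] {h : K → ℂ} (hh : Continuous h) {M : ℝ}
    (hM : ∀ t, ‖h t‖ ≤ M) (z x : K) :
    translate (haarPairing ω g h) z x =
      ∫ y, translate (translate h (inv x)) (inv z) y * g y ∂ω := by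
  have hcont : Continuous fun p : K × K => translate h (inv p.1) p.2 :=
    (continuous_translate hh hM).comp ((continuous_inv.comp continuous_fst).prodMk continuous_snd)
  refine (integral_integral_swap_of_continuous_of_bounded_compactlySupported _ ω hcont
    (fun _ => norm_translate_le hM _ _) g).trans (integral_congr_ae (.of_forall fun y => ?_))
  dsimp only
  congr 1
  rw [← translate_translate hh hM, translate, ← map_inv_conv]
  exact (integral_map continuous_inv.measurable.aemeasurable
    (continuous_translate_right hh hM y).aestronglyMeasurable).symm

theorem integral_translate_haarPairing_of_continuous [ω.Regular] {h : K → ℂ} (hh : Continuous h)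
    {M : ℝ} (hM : ∀ t, ‖h t‖ ≤ M) (z : K) :
    ∫ x, translate (haarPairing ω g h) z x ∂σ = haarPairing ω g (convFun σ h) z := by
  have hcont : Continuous fun p : K × K => translate (translate h (inv p.1)) (inv z) p.2 :=
    continuous_integral_probabilityMeasure
      (continuous_conv.comp (continuous_const.prodMk continuous_snd)) (fun _ => conv_regular _ _)
      (k := fun (p : K × K) t => translate h (inv p.1) t)
      ((continuous_translate hh hM).comp
        ((continuous_inv.comp (continuous_fst.comp continuous_fst)).prodMk continuous_snd))
      (fun _ _ => norm_translate_le hM _ _)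
  simp only [translate_haarPairing g hh hM, haarPairing, translate_convFun hh hM]
  exact integral_integral_swap_of_continuous_of_bounded_compactlySupported σ ω hcont
    (fun _ => norm_translate_le (norm_translate_le hM _) _ _) g

theorem integral_translate_haarPairing (hω : IsLeftHaar ω) (hk : Integrable k ω) (z : K) :
    ∫ x, translate (haarPairing ω g k) z x ∂σ = haarPairing ω g (convFun σ k) z := by
  have := hω.regular
  obtain ⟨M, hM0, hM⟩ := exists_forall_norm_haarPairing_sub_le g hω
  obtain ⟨F, hF⟩ := exists_zeroAtInfty_eq_haarPairing g hω hk
  refine eq_of_forall_dist_le fun ε hε => ?_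
  obtain ⟨h, hδ⟩ := exists_compactlySupported_integral_norm_sub_le hk
    (by positivity : 0 < ε / (2 * M + 1))
  set δ := ε / (2 * M + 1)
  have hh : Integrable h ω := h.continuous.integrable_of_hasCompactSupport h.hasCompactSupport
  obtain ⟨G, hG⟩ := exists_compactlySupported_eq_haarPairing g hω h
  obtain ⟨B, hB⟩ := h.hasCompactSupport.exists_bound_of_continuous h.continuous
  have hmean : ‖∫ x, translate (haarPairing ω g k) z x ∂σ -
      ∫ x, translate (haarPairing ω g h) z x ∂σ‖ ≤ M * δ := by
    rw [← hF, ← hG]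
    exact norm_integral_translate_sub_le F.toBCF G.toBoundedContinuousFunction
      (fun t => by
        change ‖F t - G t‖ ≤ _
        rw [hF, hG]
        exact (hM k h hk hh t).trans (by gcongr)) z
  have hconv : ‖haarPairing ω g (convFun σ h) z - haarPairing ω g (convFun σ k) z‖ ≤ M * δ := by
    rw [norm_sub_rev]
    refine (hM _ _ (hω.integrable_convFun hk) (hω.integrable_convFun hh) z).trans ?_
    exact mul_le_mul_of_nonneg_left ((hω.integral_norm_convFun_sub_le hk hh).trans hδ) hM0
  rw [← integral_translate_haarPairing_of_continuous g (map_continuous h) hB] at hconv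
  calc dist _ _
    _ ≤ M * δ + M * δ := by
      rw [dist_eq_norm]
      exact (norm_sub_le_norm_sub_add_norm_sub _ _ _).trans (add_le_add hmean hconv)
    _ ≤ δ * (2 * M + 1) := by linarith [show 0 < δ by positivity]
    _ = ε := div_mul_cancel₀ _ (by positivity)

end HaarPairing

section HarmonicL1

open Set

variable {K : Type*} [TopologicalSpace K] [T2Space K] [LocallyCompactSpace K]
  [MeasurableSpace K] [BorelSpace K] [Hypergroup K] {ω σ : Measure K} [IsProbabilityMeasure σ]
  [σ.Regular]

theorem integral_mul_eq_zero_of_harmonic [NoncompactSpace K] (hσ : IsNondegenerate σ)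
    (hω : IsLeftHaar ω) {k : K → ℂ} (hk : Integrable k ω) (hharm : convFun σ k =ᵐ[ω] k)
    (g : C_c(K, ℂ)) : ∫ y, k y * g y ∂ω = 0 := by
  obtain ⟨F, hF⟩ := exists_zeroAtInfty_eq_haarPairing g hω hk
  have hF0 : F = 0 := eq_zero_of_harmonic hσ F fun z => by
    rw [hF, integral_translate_haarPairing g hω hk, hω.haarPairing_congr_ae g hharm]
  have he : haarPairing ω g k e = 0 := by rw [← hF, hF0, ZeroAtInftyContinuousMap.zero_apply]
  simpa only [haarPairing, inv_e, translate_e] using he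

theorem zero_mem_harmonicL1 (hω : IsLeftHaar ω) : 0 ∈ harmonicL1 ω σ := by
  have h0 : ⇑(0 : Lp ℂ 1 ω) =ᵐ[ω] 0 := Lp.coeFn_zero ℂ 1 ω
  have hconv0 : convFun σ (0 : K → ℂ) = 0 := by
    funext x
    simp [convFun, translate]
  have hcongr := hω.convFun_congr_ae (σ := σ) (L1.integrable_coeFn 0) h0
  rw [hconv0] at hcongr
  exact hcongr.trans h0.symm

theorem harmonicL1_eq_zero [NoncompactSpace K] (hσ : IsNondegenerate σ) (hω : IsLeftHaar ω) :
    harmonicL1 ω σ = {0} := by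
  have := hω.regular
  refine Subset.antisymm (fun f hf => Lp.eq_zero_iff_ae_eq_zero.2 ?_)
    (singleton_subset_iff.2 (zero_mem_harmonicL1 hω))
  exact ae_eq_zero_of_forall_integral_mul_compactlySupported_eq_zero (L1.integrable_coeFn f)
    (integral_mul_eq_zero_of_harmonic hσ hω (L1.integrable_coeFn f) hf)

end HarmonicL1

end Hypergroup

theorem mainTheorem4 {K : Type*} [TopologicalSpace K] [T2Space K] [LocallyCompactSpace K]
    [MeasurableSpace K] [BorelSpace K] [Hypergroup K] [NoncompactSpace K]
    (σ : Measure K) [IsProbabilityMeasure σ] [σ.Regular]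
    (hσ : Hypergroup.IsNondegenerate σ) :
    Hypergroup.harmonicMeasures σ = {0} ∧
      ∀ ω : Measure K, Hypergroup.IsLeftHaar ω → Hypergroup.harmonicL1 ω σ = {0} :=
  ⟨Hypergroup.harmonicMeasures_eq_zero hσ, fun _ hω => Hypergroup.harmonicL1_eq_zero hσ hω⟩
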